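/- A candidate surface branched cover $\widetilde\Sigma \dashrightarrow \Sigma$ of degree $d\geq 1$ consists of two closed connected orientable surfaces $\widetilde\Sigma,\Sigma$ (up to homeomorphism), and a finite (possibly empty) collection $\Pi_1,\dots,\Pi_n$ of partitions $\Pi_i=(d_{ij})_{j=1}^{m_i}$ of $d$, none of them equal to $(1,\dots,1)$, satisfying the Riemann-Hurwitz condition $\chi(\widetilde\Sigma)-\sum_i m_i=d\,(\chi(\Sigma)-n)$. It is realizable if there is a branched cover $f:\widetilde\Sigma\to\Sigma$ (a map locally modelled on $z\mapsto z^m$, $m\geq 1$) of degree $d$ with exactly $n$ branching points, such that the $\Pi_i$ are the partitions of $d$ given by the local degrees of $f$ over the branching points. With $p_i=\mathrm{lcm}\{d_{ij}: j=1,\dots,m_i\}$ and $p_{ij}=p_i/d_{ij}$, it induces the candidate orbifold cover $\widetilde X\dashrightarrow X$, where $X=\Sigma(p_1,\dots,p_n)$ and $\widetilde X=\widetilde\Sigma\big((p_{ij})\big)$ are the closed orientable 2-orbifolds with the given underlying surfaces and cone orders (orders equal to $1$ being omitted). The orbifold $X$ is Euclidean if $\chi^{\mathrm{orb}}(X)=\chi(\Sigma)-\sum_i(1-1/p_i)=0$.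 Let $S$ be the 2-sphere and $T$ the torus (without cone points). Theorem. The candidate surface branched covers inducing some $T\dashrightarrow X$ are exactly the following, with arbitrary $k\geq 1$: (i) $T\dashrightarrow T$ of degree $k$ with no branching; (ii) $T\dashrightarrow S$ of degree $2k$ with partitions $(2,\dots,2),(2,\dots,2),(2,\dots,2),(2,\dots,2)$; (iii) $T\dashrightarrow S$ of degree $3k$ with partitions $(3,\dots,3),(3,\dots,3),(3,\dots,3)$; (iv) $T\dashrightarrow S$ of degree $4k$ with partitions $(2,\dots,2),(4,\dots,4),(4,\dots,4)$; (v) $T\dashrightarrow S$ of degree $6k$ with partitions $(2,\dots,2),(3,\dots,3),(6,\dots,6)$. For all of them $X$ is Euclidean, and all of them are realizable. -/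

import Mathlib

namespace Hurwitz

/-! ### Closed connected orientable surfaces -/

/-- The boundary point at parameter `t ∈ [0, 4g]` of the closed unit disc, seen as a
polygon with `4 g` edges, the `j`-th one being the arc of parameters `[j, j + 1]`. -/
noncomputable def polygonPoint (g : ℕ) (t : ℝ) : ℂ :=
  Complex.exp ((2 * Real.pi * t / (4 * g) : ℝ) * Complex.I)

/-- The edge identifications of the `4 g`-gon according to the word
`a₀ b₀ a₀⁻¹ b₀⁻¹ ⋯ a_{g-1} b_{g-1} a_{g-1}⁻¹ b_{g-1}⁻¹`. -/
def polygonRel (g : ℕ) (z w : Metric.closedBall (0 : ℂ) 1) : Prop :=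
  ∃ i : ℕ, i < g ∧ ∃ s : ℝ, 0 ≤ s ∧ s ≤ 1 ∧
    (((z : ℂ) = polygonPoint g (4 * i + s) ∧ (w : ℂ) = polygonPoint g (4 * i + 3 - s)) ∨
     ((z : ℂ) = polygonPoint g (4 * i + 1 + s) ∧ (w : ℂ) = polygonPoint g (4 * i + 4 - s)))

/-- The closed connected orientable surface of genus `g`: the round sphere for `g = 0`,
the torus `ℝ/ℤ × ℝ/ℤ` for `g = 1`, and the `4 g`-gon with its edges identified in the
standard way for `g ≥ 2`. -/
def Surface : ℕ → Type
  | 0 => Metric.sphere (0 : EuclideanSpace ℝ (Fin 3)) 1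
  | 1 => UnitAddCircle × UnitAddCircle
  | g + 2 => Quot (polygonRel (g + 2))

instance Surface.instTopologicalSpace : (g : ℕ) → TopologicalSpace (Surface g)
  | 0 => inferInstanceAs (TopologicalSpace (Metric.sphere (0 : EuclideanSpace ℝ (Fin 3)) 1))
  | 1 => inferInstanceAs (TopologicalSpace (UnitAddCircle × UnitAddCircle))
  | g + 2 => inferInstanceAs (TopologicalSpace (Quot (polygonRel (g + 2))))

/-- The Euler characteristic of the closed connected orientable surface of genus `g`. -/
def surfaceEulerChar (g : ℕ) : ℤ := 2 - 2 * g

/-! ### Branched covers -/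

/-- Around `x` the map `f` is modelled, in suitable topological charts centred at `x` and at
`f x`, on `z ↦ z ^ k` with `k ≥ 1`; that is, `f` has local degree `k` at `x`. -/
def HasLocalDegree {X Y : Type*} [TopologicalSpace X] [TopologicalSpace Y]
    (f : X → Y) (x : X) (k : ℕ) : Prop :=
  1 ≤ k ∧ ∃ (φ : OpenPartialHomeomorph X ℂ) (ψ : OpenPartialHomeomorph Y ℂ),
    x ∈ φ.source ∧ φ x = 0 ∧ f x ∈ ψ.source ∧ ψ (f x) = 0 ∧
    Set.MapsTo f φ.source ψ.source ∧ ∀ y ∈ φ.source, ψ (f y) = φ y ^ k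

/-- `f : X → Y` is a branched cover of degree `d` and `Q` is the collection, one entry for each
branching point, of the partitions of `d` formed by the local degrees over the branching points.
Here `e x` is the local degree at `x`, `F y` is the fibre over `y`, and `B` is the finite set
of branching points. -/
def IsBranchedCoverWith {X Y : Type*} [TopologicalSpace X] [TopologicalSpace Y]
    (f : X → Y) (d : ℕ) (Q : Multiset (Multiset ℕ)) : Prop :=
  ∃ (e : X → ℕ) (F : Y → Finset X) (B : Finset Y),
    (∀ x, HasLocalDegree f x (e x)) ∧
    (∀ y x, x ∈ F y ↔ f x = y) ∧
    (∀ y, y ∈ B ↔ ∃ x, f x = y ∧ 2 ≤ e x) ∧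
    (∀ y, y ∉ B → (F y).card = d) ∧
    Q = B.val.map (fun y => (F y).val.map e)

/-! ### Candidate surface branched covers -/

/-- The symbol `Σ̃ ⇢ Σ` of degree `d` with a finite collection of partitions; the surfaces are
recorded by their genera. -/
@[ext] structure BranchDatum where
  /-- genus of the covering surface -/
  coverGenus : ℕ
  /-- genus of the covered surface -/
  baseGenus : ℕ
  /-- total degree -/
  degree : ℕ
  /-- the partitions of the degree -/
  partitions : Multiset (Multiset ℕ)

/-- The datum is a candidate surface branched cover: each entry is a partition of the degree
having a part bigger than `1` (as is the case over a branching point), and the Riemann-Hurwitz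
condition `χ(Σ̃) - ℓ(Π) = d (χ(Σ) - n)` holds. -/
structure BranchDatum.IsCandidate (D : BranchDatum) : Prop where
  degree_pos : 1 ≤ D.degree
  sum_eq : ∀ P ∈ D.partitions, P.sum = D.degree
  pos : ∀ P ∈ D.partitions, ∀ a ∈ P, 1 ≤ a
  nontrivial : ∀ P ∈ D.partitions, ∃ a ∈ P, 2 ≤ a
  riemann_hurwitz :
    surfaceEulerChar D.coverGenus - ((D.partitions.map Multiset.card).sum : ℤ) =
      D.degree * (surfaceEulerChar D.baseGenus - (Multiset.card D.partitions : ℤ))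

/-- The datum is induced by some existing branched cover. -/
def BranchDatum.Realizable (D : BranchDatum) : Prop :=
  ∃ f : Surface D.coverGenus → Surface D.baseGenus,
    IsBranchedCoverWith f D.degree D.partitions

/-! ### 2-orbifolds -/

/-- A closed orientable 2-orbifold `Σ(p₁, …, pₙ)`, up to isomorphism: the genus of the
underlying surface and the orders `pᵢ ≥ 2` of the cone points. -/
@[ext] structure Orbifold where
  /-- genus of the underlying surface -/
  genus : ℕ
  /-- orders of the cone points -/
  cones : Multiset ℕ
  two_le : ∀ p ∈ cones, 2 ≤ p

/-- The orbifold with the given orders, those equal to `1` being omitted. -/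
def Orbifold.ofOrders (g : ℕ) (s : Multiset ℕ) : Orbifold where
  genus := g
  cones := s.filter (fun p => 2 ≤ p)
  two_le := fun _ hp => (Multiset.mem_filter.1 hp).2

/-- The torus, without cone points. -/
def Orbifold.torus : Orbifold where
  genus := 1
  cones := 0
  two_le := fun _ hp => absurd hp (Multiset.notMem_zero _)

/-- The orbifold Euler characteristic `χ(Σ) - ∑ (1 - 1 / pᵢ)`. -/
def Orbifold.eulerChar (X : Orbifold) : ℚ :=
  surfaceEulerChar X.genus - (X.cones.map (fun p : ℕ => 1 - 1 / (p : ℚ))).sum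

/-- Euclidean 2-orbifolds are those of vanishing orbifold Euler characteristic. -/
def Orbifold.IsEuclidean (X : Orbifold) : Prop := X.eulerChar = 0

/-- The target `X = Σ(p₁, …, pₙ)` of the induced candidate orbifold cover, where `pᵢ` is the
least common multiple of the parts of the `i`-th partition. -/
def BranchDatum.baseOrbifold (D : BranchDatum) : Orbifold :=
  Orbifold.ofOrders D.baseGenus (D.partitions.map Multiset.lcm)

/-- The source `X̃ = Σ̃((pᵢⱼ))` of the induced candidate orbifold cover, where
`pᵢⱼ = pᵢ / dᵢⱼ`. -/
def BranchDatum.coverOrbifold (D : BranchDatum) : Orbifold :=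
  Orbifold.ofOrders D.coverGenus
    (D.partitions.bind (fun P => P.map (fun a => P.lcm / a)))

/-- The datum induces the candidate orbifold cover `X̃ ⇢ X`. -/
def BranchDatum.Induces (D : BranchDatum) (Xt X : Orbifold) : Prop :=
  D.coverOrbifold = Xt ∧ D.baseOrbifold = X

/-- The partition `(a, …, a)` with `m` parts. -/
abbrev parts (m a : ℕ) : Multiset ℕ := Multiset.replicate m a

end Hurwitz

namespace Hurwitz

open Filter Topology

/-! ### Candidates inducing the torus -/

/-! Classification. If the cover orbifold has no cone points, every quotient `P.lcm / a` is 1, so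
each partition is constant, equal to `(p, …, p)` with `d / p` parts. Dividing Riemann-Hurwitz by `d`
then gives `∑ (1 - 1 / pᵢ) = 2 - 2 g`, that is, `X` is Euclidean. All summands lie in `[1/2, 1)`, so
genus at least 2 is impossible, genus 1 leaves no branching, and genus 0 leaves the orders
`2,2,2,2`, `3,3,3`, `2,4,4`, `2,3,6` (`euclidean_cones`). Each order divides `d`, whence the factor
`k`.

Realization. For `n = 2, 3, 4, 6` take a lattice invariant under a rotation of order `n` and the
elliptic function `℘`, `℘'`, `℘²`, `℘'²` respectively. It is invariant under the rotation and its
only pole modulo periods is at 0, of order `n`. The induced map from the torus to the Riemann sphere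
is the quotient by the rotation, and no branch value has to be computed to see this. The sum of
local degrees over a fibre is constant (`sum_localDegree_fiber_const`), and equals `n` because the
fibre over infinity is one point of local degree `n`. At a point of period `m` under the rotation,
comparing leading coefficients of the local expansion shows that `n ∣ m e`, with `e` the local
degree (`exists_hasLocalDegree_of_notMem`). An orbit of `m` points thus already uses up the total
`n`, so it is the whole fibre and `e = n / m` (`fiber_eq_orbit`). The branching is therefore read
off from the non-free orbits of an explicit integer matrix on `ℝ/ℤ × ℝ/ℤ`. Precomposing with a
`k`-fold unbranched self-covering of the torus yields degree `n k`; that covering alone realizes the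
family without branching. -/

theorem BranchDatum.IsCandidate.eq_replicate_of_cover_eq_torus {D : BranchDatum}
    (hD : D.IsCandidate) (h : D.coverOrbifold = Orbifold.torus) {P : Multiset ℕ}
    (hP : P ∈ D.partitions) : P = Multiset.replicate (Multiset.card P) P.lcm := by
  rw [Multiset.eq_replicate]
  refine ⟨rfl, fun a ha => ?_⟩
  have hc : (D.partitions.bind (fun P => P.map (fun a => P.lcm / a))).filter (fun p => 2 ≤ p) = 0 :=
    congrArg Orbifold.cones h
  rw [Multiset.filter_eq_nil] at hc
  have h2 := hc (P.lcm / a) (Multiset.mem_bind.2 ⟨P, hP, Multiset.mem_map_of_mem _ ha⟩)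
  have hne : P.lcm ≠ 0 := by
    rw [Ne, Multiset.lcm_eq_zero_iff]
    intro h0
    have := hD.pos P hP 0 h0
    omega
  obtain ⟨c, hc⟩ := Multiset.dvd_lcm ha
  have ha0 : 0 < a := hD.pos P hP a ha
  rw [hc, Nat.mul_div_cancel_left _ ha0] at h2
  -- The quotient `c` is nonzero because the lcm is, and it is not at least 2 because it would
  -- survive as a cone order.
  have hc1 : c = 1 := by
    rcases c with _ | _ | c
    · simp [hc] at hne
    · rfl
    · omega
  rw [hc, hc1, mul_one]

theorem BranchDatum.IsCandidate.two_le_lcm {D : BranchDatum} (hD : D.IsCandidate)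
    {P : Multiset ℕ} (hP : P ∈ D.partitions) : 2 ≤ P.lcm := by
  obtain ⟨a, ha, ha2⟩ := hD.nontrivial P hP
  refine ha2.trans (Nat.le_of_dvd (Nat.pos_of_ne_zero ?_) (Multiset.dvd_lcm ha))
  rw [Ne, Multiset.lcm_eq_zero_iff]
  intro h0
  have := hD.pos P hP 0 h0
  omega

theorem BranchDatum.IsCandidate.card_mul_lcm {D : BranchDatum}
    (hD : D.IsCandidate) (h : D.coverOrbifold = Orbifold.torus) {P : Multiset ℕ}
    (hP : P ∈ D.partitions) : Multiset.card P * P.lcm = D.degree := by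
  rw [← hD.sum_eq P hP]
  conv_rhs => rw [hD.eq_replicate_of_cover_eq_torus h hP]
  simp

theorem BranchDatum.IsCandidate.sum_one_sub_inv {D : BranchDatum}
    (hD : D.IsCandidate) (h : D.coverOrbifold = Orbifold.torus) :
    ((D.partitions.map Multiset.lcm).map (fun p : ℕ => 1 - 1 / (p : ℚ))).sum =
      2 - 2 * (D.baseGenus : ℚ) := by
  have hg : D.coverGenus = 1 := congrArg Orbifold.genus h
  have hd : (D.degree : ℚ) ≠ 0 := by have := hD.degree_pos; positivity
  have hr := hD.riemann_hurwitz
  rw [hg] at hr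
  simp only [surfaceEulerChar] at hr
  have hr' : (((D.partitions.map Multiset.card).sum : ℕ) : ℚ) =
      D.degree * (Multiset.card D.partitions - (2 - 2 * D.baseGenus : ℚ)) := by
    generalize (D.partitions.map Multiset.card).sum = S at hr ⊢
    have hr2 := congrArg (Int.cast : ℤ → ℚ) hr
    push_cast at hr2
    linarith
  -- A constant partition with entry `p` has `d / p` parts, so the total length is `d ∑ 1 / pᵢ` and
  -- `d` cancels from Riemann-Hurwitz.
  have hs : (((D.partitions.map Multiset.card).sum : ℕ) : ℚ) =
      (D.partitions.map (fun P => (D.degree : ℚ) * (1 / (P.lcm : ℚ)))).sum := by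
    rw [Nat.cast_multiset_sum, Multiset.map_map]
    congr 1
    refine Multiset.map_congr rfl fun P hP => ?_
    have h2 := hD.two_le_lcm hP
    have h0 : (P.lcm : ℚ) ≠ 0 := by positivity
    rw [← hD.card_mul_lcm h hP]
    push_cast
    simp only [Function.comp]
    field_simp
  rw [Multiset.sum_map_mul_left, hr'] at hs
  have hs' := mul_left_cancel₀ hd hs
  rw [Multiset.map_map, show ((fun p : ℕ => 1 - 1 / (p : ℚ)) ∘ Multiset.lcm) =
    fun P : Multiset ℕ => (1 : ℚ) - 1 / (P.lcm : ℚ) from rfl, Multiset.sum_map_sub, ← hs']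
  simp

theorem BranchDatum.IsCandidate.isEuclidean_baseOrbifold {D : BranchDatum}
    (hD : D.IsCandidate) (h : D.coverOrbifold = Orbifold.torus) : D.baseOrbifold.IsEuclidean := by
  have hc : D.baseOrbifold.cones = D.partitions.map Multiset.lcm := by
    refine Multiset.filter_eq_self.2 fun p hp => ?_
    obtain ⟨P, hP, rfl⟩ := Multiset.mem_map.1 hp
    exact hD.two_le_lcm hP
  rw [Orbifold.IsEuclidean, Orbifold.eulerChar, hc, hD.sum_one_sub_inv h]
  simp [BranchDatum.baseOrbifold, Orbifold.ofOrders, surfaceEulerChar]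

/-- The reciprocals add up to 1. If `a ≥ 4` they add up to at most 3/4, and if `b, c ≥ 5` to at most
1/2 + 2/5; this leaves finitely many `a, b`, each determining `c`. -/
theorem euclidean_triples {a b c : ℕ} (ha : 2 ≤ a) (hab : a ≤ b) (hbc : b ≤ c)
    (h : (1 - 1 / (a : ℚ)) + (1 - 1 / (b : ℚ)) + (1 - 1 / (c : ℚ)) = 2) :
    (a = 3 ∧ b = 3 ∧ c = 3) ∨ (a = 2 ∧ b = 4 ∧ c = 4) ∨ (a = 2 ∧ b = 3 ∧ c = 6) := by
  have ha0 : (0 : ℚ) < a := by positivity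
  have hb0 : (0 : ℚ) < b := by have : 0 < b := by omega
                               positivity
  have hc0 : (0 : ℚ) < c := by have : 0 < c := by omega
                               positivity
  have key : b * c + a * c + a * b = a * b * c := by
    have : (b * c + a * c + a * b : ℚ) = a * b * c := by
      field_simp at h
      linarith
    exact_mod_cast this
  have ha3 : a ≤ 3 := by
    by_contra! h3
    have h1 : 4 * (b * c) ≤ a * (b * c) := Nat.mul_le_mul_right _ h3
    have h2 : a * c ≤ b * c := Nat.mul_le_mul_right _ hab
    have h3 : a * b ≤ b * c := by rw [mul_comm]; exact Nat.mul_le_mul_left _ (hab.trans hbc)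
    have h4 : 0 < b * c := Nat.mul_pos (by omega) (by omega)
    nlinarith
  have hbu : b ≤ 4 := by
    by_contra! h3
    have h4 : a * b ≤ a * c := Nat.mul_le_mul_left _ hbc
    have h5 : 5 * c ≤ b * c := Nat.mul_le_mul_right _ h3
    interval_cases a <;> nlinarith
  have hb2 : 2 ≤ b := by omega
  interval_cases a <;> interval_cases b <;> omega

/-- Summands in `[1/2, 1)` with total 2 number three or four, and with four of them each must equal
1/2. -/
theorem euclidean_cones {s : Multiset ℕ} (hs : ∀ p ∈ s, 2 ≤ p)
    (h : (s.map (fun p : ℕ => 1 - 1 / (p : ℚ))).sum = 2) :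
    s = {2, 2, 2, 2} ∨ s = {3, 3, 3} ∨ s = {2, 4, 4} ∨ s = {2, 3, 6} := by
  have hlb : ∀ p : ℕ, 2 ≤ p → (1 / 2 : ℚ) ≤ 1 - 1 / (p : ℚ) := fun p hp => by
    have : (1 : ℚ) / p ≤ 1 / 2 := by
      apply one_div_le_one_div_of_le <;> norm_num
      exact hp
    linarith
  have hcard : (Multiset.card s : ℚ) * (1 / 2) ≤ 2 := by
    refine le_of_le_of_eq ?_ h
    have := Multiset.card_nsmul_le_sum (s := s.map (fun p : ℕ => 1 - 1 / (p : ℚ))) (a := 1 / 2)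
      (by
        intro x hx
        obtain ⟨p, hp, rfl⟩ := Multiset.mem_map.1 hx
        exact hlb p (hs p hp))
    simpa using this
  have hcard' : Multiset.card s ≤ 4 := by
    have : (Multiset.card s : ℚ) ≤ 4 := by linarith
    exact_mod_cast this
  obtain ⟨l, hl, hls⟩ : ∃ l : List ℕ, l.Pairwise (· ≤ ·) ∧ (l : Multiset ℕ) = s :=
    ⟨s.sort (· ≤ ·), Multiset.pairwise_sort s (· ≤ ·), Multiset.sort_eq s (· ≤ ·)⟩
  subst hls
  have hs' : ∀ p ∈ l, 2 ≤ p := fun p hp => hs p (by simpa using hp)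
  rcases l with _ | ⟨a, _ | ⟨b, _ | ⟨c, _ | ⟨d, _ | ⟨e, l⟩⟩⟩⟩⟩
  · simp at h
  · simp at h
    have : (0 : ℚ) ≤ (a : ℚ)⁻¹ := by positivity
    linarith
  · simp at h
    have h1 : (0 : ℚ) < (a : ℚ)⁻¹ := by have := hs' a (by simp); positivity
    have h2 : (0 : ℚ) < (b : ℚ)⁻¹ := by have := hs' b (by simp); positivity
    linarith
  · simp only [List.pairwise_cons, List.mem_cons] at hl
    simp only [Multiset.map_coe, Multiset.sum_coe, List.map_cons, List.map_nil, List.sum_cons,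
      List.sum_nil, add_zero] at h
    rcases euclidean_triples (hs' a (by simp)) (hl.1 b (by simp)) (hl.2.1 c (by simp))
      (by linarith) with ⟨rfl, rfl, rfl⟩ | ⟨rfl, rfl, rfl⟩ | ⟨rfl, rfl, rfl⟩
    · exact Or.inr (Or.inl rfl)
    · exact Or.inr (Or.inr (Or.inl rfl))
    · exact Or.inr (Or.inr (Or.inr rfl))
  · have htwo : ∀ p : ℕ, 2 ≤ p → (1 - 1 / (p : ℚ)) ≤ 1 / 2 → p = 2 := by
      intro p hp h2
      have h3 : (1 / 2 : ℚ) ≤ 1 / p := by linarith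
      have h4 : (p : ℚ) ≤ 2 := by
        rwa [one_div_le_one_div (by norm_num) (by positivity)] at h3
      have : p ≤ 2 := by exact_mod_cast h4
      omega
    have h1 := hlb a (hs' a (by simp))
    have h2 := hlb b (hs' b (by simp))
    have h3 := hlb c (hs' c (by simp))
    have h4 := hlb d (hs' d (by simp))
    simp only [Multiset.map_coe, Multiset.sum_coe, List.map_cons, List.map_nil, List.sum_cons,
      List.sum_nil, add_zero] at h
    rw [htwo a (hs' a (by simp)) (by linarith), htwo b (hs' b (by simp)) (by linarith),
      htwo c (hs' c (by simp)) (by linarith), htwo d (hs' d (by simp)) (by linarith)]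
    exact Or.inl rfl
  · simp at hcard'
    omega

theorem BranchDatum.IsCandidate.mem_list_of_cover_eq_torus {D : BranchDatum}
    (hD : D.IsCandidate) (h : D.coverOrbifold = Orbifold.torus) :
    ∃ k : ℕ, 1 ≤ k ∧
      (D = ⟨1, 1, k, 0⟩ ∨
       D = ⟨1, 0, 2 * k, {parts k 2, parts k 2, parts k 2, parts k 2}⟩ ∨
       D = ⟨1, 0, 3 * k, {parts k 3, parts k 3, parts k 3}⟩ ∨
       D = ⟨1, 0, 4 * k, {parts (2 * k) 2, parts k 4, parts k 4}⟩ ∨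
       D = ⟨1, 0, 6 * k, {parts (3 * k) 2, parts (2 * k) 3, parts k 6}⟩) := by
  have hsum := hD.sum_one_sub_inv h
  have hcover : D.coverGenus = 1 := congrArg Orbifold.genus h
  -- The degree and the lcms determine the partitions, so from here on only the multiset of lcms
  -- matters.
  have hmap : D.partitions =
      (D.partitions.map Multiset.lcm).map (fun p => Multiset.replicate (D.degree / p) p) := by
    rw [Multiset.map_map]
    conv_lhs => rw [← Multiset.map_id D.partitions]
    refine Multiset.map_congr rfl fun P hP => ?_
    have h2 := hD.two_le_lcm hP
    simp only [id, Function.comp]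
    rw [← hD.card_mul_lcm h hP, Nat.mul_div_cancel _ (by omega)]
    exact hD.eq_replicate_of_cover_eq_torus h hP
  have hdvd : ∀ p ∈ D.partitions.map Multiset.lcm, p ∣ D.degree := by
    intro p hp
    obtain ⟨P, hP, rfl⟩ := Multiset.mem_map.1 hp
    exact ⟨_, by rw [mul_comm]; exact (hD.card_mul_lcm h hP).symm⟩
  have htwo : ∀ p ∈ D.partitions.map Multiset.lcm, 2 ≤ p := by
    intro p hp
    obtain ⟨P, hP, rfl⟩ := Multiset.mem_map.1 hp
    exact hD.two_le_lcm hP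
  generalize D.partitions.map Multiset.lcm = s at hsum hmap hdvd htwo
  have hpos := hD.degree_pos
  obtain ⟨gt, g, d, Q⟩ := D
  dsimp only at *
  subst hcover
  have hlb : (Multiset.card s : ℚ) * (1 / 2) ≤ 2 - 2 * g := by
    rw [← hsum]
    have := Multiset.card_nsmul_le_sum (s := s.map (fun p : ℕ => 1 - 1 / (p : ℚ))) (a := 1 / 2)
      (by
        intro x hx
        obtain ⟨p, hp, rfl⟩ := Multiset.mem_map.1 hx
        have hp2 : ((2 : ℕ) : ℚ) ≤ p := by exact_mod_cast htwo p hp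
        have : (1 : ℚ) / p ≤ 1 / 2 := by
          apply one_div_le_one_div_of_le
          · norm_num
          · simpa using hp2
        linarith)
    simpa using this
  rcases g with _ | _ | g
  · simp only [CharP.cast_eq_zero, mul_zero, sub_zero] at hsum
    rcases euclidean_cones htwo hsum with rfl | rfl | rfl | rfl
    · obtain ⟨k, rfl⟩ := hdvd 2 (by simp)
      refine ⟨k, by omega, Or.inr (Or.inl ?_)⟩
      simp [hmap]
    · obtain ⟨k, rfl⟩ := hdvd 3 (by simp)
      refine ⟨k, by omega, Or.inr (Or.inr (Or.inl ?_))⟩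
      simp [hmap]
    · obtain ⟨k, rfl⟩ := hdvd 4 (by simp)
      refine ⟨k, by omega, Or.inr (Or.inr (Or.inr (Or.inl ?_)))⟩
      rw [hmap]
      simp [show 4 * k / 2 = 2 * k by omega]
    · obtain ⟨k, rfl⟩ := hdvd 6 (by simp)
      refine ⟨k, by omega, Or.inr (Or.inr (Or.inr (Or.inr ?_)))⟩
      rw [hmap]
      simp [show 6 * k / 2 = 3 * k by omega, show 6 * k / 3 = 2 * k by omega]
  · have h0 : Multiset.card s = 0 := by
      have : (Multiset.card s : ℚ) ≤ 0 := by push_cast at hlb; linarith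
      have : Multiset.card s ≤ 0 := by exact_mod_cast this
      omega
    rw [Multiset.card_eq_zero] at h0
    exact ⟨d, hpos, Or.inl (by simp [hmap, h0])⟩
  · exfalso
    have : (0 : ℚ) ≤ (Multiset.card s : ℚ) := by positivity
    have : (0 : ℚ) ≤ g := by positivity
    push_cast at hlb
    linarith

/-- Treats all five families at once: a pair `(m, a)` stands for the partition with `m` parts equal
to `a`. Its lcm divides `a`, so the quotients are at most 1 and no cone point survives in the cover.
-/
theorem isCandidate_induces_torus_of_parts {g d : ℕ} {s : Multiset (ℕ × ℕ)} (hd : 1 ≤ d)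
    (hs : ∀ x ∈ s, 1 ≤ x.1 ∧ 2 ≤ x.2 ∧ x.1 * x.2 = d)
    (hrh : ((s.map Prod.fst).sum : ℤ) = d * (2 * g - 2 + Multiset.card s)) :
    (⟨1, g, d, s.map fun x => parts x.1 x.2⟩ : BranchDatum).IsCandidate ∧
      (⟨1, g, d, s.map fun x => parts x.1 x.2⟩ : BranchDatum).coverOrbifold = Orbifold.torus := by
  refine ⟨⟨hd, ?_, ?_, ?_, ?_⟩, ?_⟩
  · intro P hP
    obtain ⟨x, hx, rfl⟩ := Multiset.mem_map.1 hP
    simpa using (hs x hx).2.2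
  · intro P hP a ha
    obtain ⟨x, hx, rfl⟩ := Multiset.mem_map.1 hP
    rw [Multiset.eq_of_mem_replicate ha]
    have := (hs x hx).2.1
    omega
  · intro P hP
    obtain ⟨x, hx, rfl⟩ := Multiset.mem_map.1 hP
    refine ⟨x.2, Multiset.mem_replicate.2 ⟨?_, rfl⟩, (hs x hx).2.1⟩
    have := (hs x hx).1
    omega
  · simp only [surfaceEulerChar, Multiset.map_map, Multiset.card_map, Function.comp_def,
      Multiset.card_replicate]
    have : (s.map Prod.fst).sum = (s.map fun x => x.1).sum := rfl
    rw [← this]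
    push_cast
    push_cast at hrh
    linarith
  · have hc : ((s.map fun x => parts x.1 x.2).bind (fun P => P.map (fun a => P.lcm / a))).filter
        (fun p => 2 ≤ p) = 0 := by
      rw [Multiset.filter_eq_nil]
      intro b hb
      obtain ⟨P, hP, hb⟩ := Multiset.mem_bind.1 hb
      obtain ⟨x, hx, rfl⟩ := Multiset.mem_map.1 hP
      obtain ⟨a, ha, rfl⟩ := Multiset.mem_map.1 hb
      have hax := Multiset.eq_of_mem_replicate ha
      subst hax
      have hl : (parts x.1 x.2).lcm ∣ x.2 := Multiset.lcm_dvd.2 fun c hc => by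
        rw [Multiset.eq_of_mem_replicate hc]
      have := Nat.div_le_div_right (c := x.2) (Nat.le_of_dvd (by have := (hs x hx).2.1; omega) hl)
      rw [Nat.div_self (by have := (hs x hx).2.1; omega)] at this
      omega
    unfold BranchDatum.coverOrbifold Orbifold.ofOrders Orbifold.torus
    congr 1

theorem isCandidate_and_cover_eq_torus {D : BranchDatum} {k : ℕ} (hk : 1 ≤ k)
    (h : D = ⟨1, 1, k, 0⟩ ∨
       D = ⟨1, 0, 2 * k, {parts k 2, parts k 2, parts k 2, parts k 2}⟩ ∨
       D = ⟨1, 0, 3 * k, {parts k 3, parts k 3, parts k 3}⟩ ∨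
       D = ⟨1, 0, 4 * k, {parts (2 * k) 2, parts k 4, parts k 4}⟩ ∨
       D = ⟨1, 0, 6 * k, {parts (3 * k) 2, parts (2 * k) 3, parts k 6}⟩) :
    D.IsCandidate ∧ D.coverOrbifold = Orbifold.torus := by
  rcases h with rfl | rfl | rfl | rfl | rfl
  · exact isCandidate_induces_torus_of_parts (s := 0) hk (by simp) (by simp)
  · exact isCandidate_induces_torus_of_parts (s := {(k, 2), (k, 2), (k, 2), (k, 2)})
      (by omega) (by simp; omega) (by simp; ring)
  · exact isCandidate_induces_torus_of_parts (s := {(k, 3), (k, 3), (k, 3)})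
      (by omega) (by simp; omega) (by simp; ring)
  · exact isCandidate_induces_torus_of_parts (s := {(2 * k, 2), (k, 4), (k, 4)})
      (by omega) (by simp; omega) (by simp; ring)
  · exact isCandidate_induces_torus_of_parts (s := {(3 * k, 2), (2 * k, 3), (k, 6)})
      (by omega) (by simp; omega) (by simp; ring)

/-! ### Local degrees -/

section LocalDegree

variable {X Y Z : Type*} [TopologicalSpace X] [TopologicalSpace Y] [TopologicalSpace Z]

/-- Continuity is not part of the definition of local degree; it follows because `f` maps the source
of `φ` into that of `ψ`, so that near `x` it is `ψ.symm` applied to `φ ^ k`. -/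
theorem HasLocalDegree.continuousAt {f : X → Y} {x : X} {k : ℕ} (h : HasLocalDegree f x k) :
    ContinuousAt f x := by
  obtain ⟨hk, φ, ψ, hx, hx0, hy, hy0, hm, he⟩ := h
  have hf : f =ᶠ[𝓝 x] fun y => ψ.symm (φ y ^ k) := by
    filter_upwards [φ.open_source.mem_nhds hx] with y hys
    rw [← he y hys, ψ.left_inv (hm hys)]
  refine ContinuousAt.congr ?_ hf.symm
  have h1 : ContinuousAt (fun y => φ y ^ k) x := (φ.continuousAt hx).pow k
  have h2 : ContinuousAt ψ.symm (φ x ^ k) := by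
    rw [← he x hx]
    exact ψ.symm.continuousAt (ψ.map_source hy)
  exact ContinuousAt.comp (f := fun y => φ y ^ k) h2 h1

theorem HasLocalDegree.comp_openPartialHomeomorph {f : X → Y} {g : Z → Y} {k : ℕ}
    (e : OpenPartialHomeomorph Z X) {z : Z} (hz : z ∈ e.source)
    (hg : ∀ w ∈ e.source, g w = f (e w)) (h : HasLocalDegree f (e z) k) :
    HasLocalDegree g z k := by
  obtain ⟨hk, φ, ψ, hx, hx0, hy, hy0, hm, he⟩ := h
  refine ⟨hk, e.trans φ, ψ, ?_, hx0, ?_, ?_, ?_, ?_⟩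
  · rw [OpenPartialHomeomorph.trans_source]
    exact ⟨hz, hx⟩
  · rwa [hg z hz]
  · rwa [hg z hz]
  · intro w hw
    rw [OpenPartialHomeomorph.trans_source] at hw
    rw [hg w hw.1]
    exact hm hw.2
  · intro w hw
    rw [OpenPartialHomeomorph.trans_source] at hw
    rw [hg w hw.1]
    exact he _ hw.2

theorem HasLocalDegree.of_comp_openPartialHomeomorph {f : X → Y} {g : Z → Y} {k : ℕ}
    (e : OpenPartialHomeomorph Z X) {z : Z} (hz : z ∈ e.source)
    (hg : ∀ w ∈ e.source, g w = f (e w)) (h : HasLocalDegree g z k) :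
    HasLocalDegree f (e z) k := by
  refine HasLocalDegree.comp_openPartialHomeomorph e.symm (e.map_source hz) ?_
    (by rwa [e.left_inv hz] : HasLocalDegree g (e.symm (e z)) k)
  intro w hw
  rw [hg _ (e.map_target hw), e.right_inv hw]

/-- Allows local degrees on the torus to be computed on its universal covering. -/
theorem hasLocalDegree_comp_isLocalHomeomorph {f : X → Y} {p : Z → X} (hp : IsLocalHomeomorph p)
    {z : Z} {k : ℕ} : HasLocalDegree (f ∘ p) z k ↔ HasLocalDegree f (p z) k := by
  obtain ⟨e, hz, rfl⟩ := hp z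
  exact ⟨fun h => h.of_comp_openPartialHomeomorph e hz fun _ _ => rfl,
    fun h => h.comp_openPartialHomeomorph e hz fun _ _ => rfl⟩

theorem HasLocalDegree.homeomorph_comp {f : X → Y} {x : X} {k : ℕ} (e : Y ≃ₜ Z)
    (h : HasLocalDegree f x k) : HasLocalDegree (e ∘ f) x k := by
  obtain ⟨hk, φ, ψ, hx, hx0, hy, hy0, hm, he⟩ := h
  refine ⟨hk, φ, e.symm.toOpenPartialHomeomorph.trans ψ, hx, hx0, ?_, ?_, ?_, ?_⟩
  · simpa using hy
  · simpa using hy0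
  · intro w hw
    simpa using hm hw
  · intro w hw
    simpa using he w hw

theorem hasLocalDegree_id_of_chart (χ : OpenPartialHomeomorph X ℂ) {x : X} (hx : x ∈ χ.source) :
    HasLocalDegree (id : X → X) x 1 := by
  refine ⟨le_rfl, χ.trans (Homeomorph.addRight (-χ x)).toOpenPartialHomeomorph,
    χ.trans (Homeomorph.addRight (-χ x)).toOpenPartialHomeomorph, ?_, ?_, ?_, ?_, ?_, ?_⟩ <;>
  simp [hx, Set.mapsTo_id]

theorem exists_finset_pow_eq {k : ℕ} (hk : 1 ≤ k) {w : ℂ} (hw : w ≠ 0) :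
    ∃ s : Finset ℂ, s.card = k ∧ ∀ z, z ∈ s ↔ z ^ k = w := by
  classical
  have hk0 : k ≠ 0 := by omega
  have hζ := Complex.isPrimitiveRoot_exp k hk0
  refine ⟨(Polynomial.nthRoots k w).toFinset, ?_, fun z => ?_⟩
  · rw [Multiset.toFinset_card_of_nodup (hζ.nthRoots_nodup hw), hζ.card_nthRoots, if_pos]
    exact ⟨w ^ ((k : ℂ)⁻¹), Complex.cpow_nat_inv_pow w hk0⟩
  · rw [Multiset.mem_toFinset, Polynomial.mem_nthRoots (by omega)]

theorem exists_injOn_pow {k : ℕ} (hk : 1 ≤ k) {z : ℂ} (hz : z ≠ 0) :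
    ∃ N ∈ 𝓝 z, Set.InjOn (fun w : ℂ => w ^ k) N := by
  have hd : HasStrictDerivAt (fun w : ℂ => w ^ k) (k * z ^ (k - 1)) z := hasStrictDerivAt_pow k z
  have hne : (k * z ^ (k - 1) : ℂ) ≠ 0 := by
    have : (k : ℂ) ≠ 0 := by exact_mod_cast (by omega : k ≠ 0)
    positivity
  let e := (hd.hasStrictFDerivAt_equiv hne).toOpenPartialHomeomorph
  exact ⟨e.source, e.open_source.mem_nhds
    (hd.hasStrictFDerivAt_equiv hne).mem_toOpenPartialHomeomorph_source, e.injOn⟩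

/-- The structure of the fibres of `f` near a point of local degree `k`. -/
theorem HasLocalDegree.exists_local_fibers {f : X → Y} {x : X} {k : ℕ}
    (h : HasLocalDegree f x k) {W : Set X} (hW : W ∈ 𝓝 x) :
    ∃ U : Set X, IsOpen U ∧ x ∈ U ∧ U ⊆ W ∧ (∀ x' ∈ U, f x' = f x → x' = x) ∧
      (∀ x' ∈ U, x' ≠ x → ∃ N ∈ 𝓝 x', Set.InjOn f N) ∧
      ∃ V : Set Y, IsOpen V ∧ f x ∈ V ∧ (∃ y ∈ V, y ≠ f x) ∧
        ∀ y ∈ V, y ≠ f x → ∃ s : Finset X, s.card = k ∧ (s : Set X) = U ∩ f ⁻¹' {y} := by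
  classical
  obtain ⟨hk, φ, ψ, hx, hx0, hy, hy0, hm, he⟩ := h
  have hk0 : k ≠ 0 := by omega
  have h0φ : (0 : ℂ) ∈ φ.target := hx0 ▸ φ.map_source hx
  have h0ψ : (0 : ℂ) ∈ ψ.target := hy0 ▸ ψ.map_source hy
  have hφ0 : φ.symm 0 = x := by rw [← hx0, φ.left_inv hx]
  have hψ0 : ψ.symm 0 = f x := by rw [← hy0, ψ.left_inv hy]
  have hnhds : φ.target ∩ φ.symm ⁻¹' W ∈ 𝓝 (0 : ℂ) := by
    refine inter_mem (φ.open_target.mem_nhds h0φ) ?_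
    have := φ.symm.continuousAt h0φ
    exact this (by rwa [hφ0])
  have hnhds' : ψ.target ∈ 𝓝 (0 : ℂ) := ψ.open_target.mem_nhds h0ψ
  obtain ⟨r, hr, hrs⟩ := Metric.mem_nhds_iff.1 hnhds
  obtain ⟨r', hr', hrs'⟩ := Metric.mem_nhds_iff.1 hnhds'
  have hinj : ∀ a ∈ φ.source, ∀ b ∈ φ.source, φ a ^ k = φ b ^ k → f a = f b := by
    intro a ha b hb hab
    refine ψ.injOn (hm ha) (hm hb) ?_
    rw [he a ha, he b hb, hab]
  -- The radii `r` upstairs and `r ^ k` downstairs are matched so that all `k` roots of a value in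
  -- the small ball lie in the chart.
  refine ⟨φ.source ∩ φ ⁻¹' Metric.ball 0 r, φ.isOpen_inter_preimage Metric.isOpen_ball,
    ⟨hx, by simp [hx0, hr]⟩, ?_, ?_, ?_, ψ.source ∩ ψ ⁻¹' Metric.ball 0 (r ^ k),
    ψ.isOpen_inter_preimage Metric.isOpen_ball, ⟨hy, by simp [hy0, hr]⟩, ?_, ?_⟩
  · rintro w ⟨hw, hwr⟩
    have := (hrs hwr).2
    rwa [Set.mem_preimage, φ.left_inv hw] at this
  · rintro w ⟨hw, -⟩ hfw
    have h1 : φ w ^ k = 0 := by rw [← he w hw, hfw, hy0]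
    rw [← φ.left_inv hw, (pow_eq_zero_iff hk0).1 h1, hφ0]
  · rintro w ⟨hw, -⟩ hwx
    have hw0 : φ w ≠ 0 := by
      intro h0
      apply hwx
      rw [← φ.left_inv hw, h0, hφ0]
    obtain ⟨N, hN, hNi⟩ := exists_injOn_pow hk hw0
    refine ⟨φ.source ∩ φ ⁻¹' N, inter_mem (φ.open_source.mem_nhds hw) (φ.continuousAt hw hN), ?_⟩
    rintro a ⟨ha, haN⟩ b ⟨hb, hbN⟩ hab
    refine φ.injOn ha hb (hNi haN hbN ?_)
    simp only
    rw [← he a ha, ← he b hb, hab]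
  · obtain ⟨t, ht0, ht⟩ : ∃ t : ℝ, 0 < t ∧ t < min r' (r ^ k) :=
      exists_between (lt_min hr' (pow_pos hr k))
    have htn : ‖(t : ℂ)‖ = t := by simp [abs_of_pos ht0]
    have htt : (t : ℂ) ∈ ψ.target := hrs' (by
      rw [mem_ball_zero_iff, htn]; exact ht.trans_le (min_le_left _ _))
    refine ⟨ψ.symm t, ⟨ψ.map_target htt, ?_⟩, ?_⟩
    · rw [Set.mem_preimage, ψ.right_inv htt, mem_ball_zero_iff, htn]
      exact ht.trans_le (min_le_right _ _)
    · intro h0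
      have := congrArg ψ h0
      rw [ψ.right_inv htt, hy0] at this
      have : t = 0 := by exact_mod_cast this
      exact ht0.ne' this
  · rintro y ⟨hys, hyr⟩ hyx
    have hw0 : ψ y ≠ 0 := by
      intro h0
      apply hyx
      rw [← ψ.left_inv hys, h0, hψ0]
    obtain ⟨s, hs, hsm⟩ := exists_finset_pow_eq hk hw0
    have hsr : ∀ z ∈ s, z ∈ Metric.ball (0 : ℂ) r := by
      intro z hz
      rw [Set.mem_preimage, mem_ball_zero_iff, ← (hsm z).1 hz, norm_pow] at hyr
      rw [mem_ball_zero_iff]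
      exact lt_of_pow_lt_pow_left₀ k hr.le hyr
    refine ⟨s.image φ.symm, ?_, ?_⟩
    · rw [Finset.card_image_of_injOn, hs]
      intro a ha b hb hab
      exact φ.symm.injOn (hrs (hsr a ha)).1 (hrs (hsr b hb)).1 hab
    · ext w
      simp only [Finset.coe_image, Set.mem_image, Finset.mem_coe, Set.mem_inter_iff,
        Set.mem_preimage, Set.mem_singleton_iff]
      constructor
      · rintro ⟨z, hz, rfl⟩
        have hzt := (hrs (hsr z hz)).1
        refine ⟨⟨φ.map_target hzt, by rw [φ.right_inv hzt]; exact hsr z hz⟩, ?_⟩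
        refine ψ.injOn (hm (φ.map_target hzt)) hys ?_
        rw [he _ (φ.map_target hzt), φ.right_inv hzt]
        exact (hsm z).1 hz
      · rintro ⟨⟨hw, hwr⟩, rfl⟩
        exact ⟨φ w, (hsm _).2 (he w hw).symm, φ.left_inv hw⟩

/-- Some value close to `f x` has exactly `k` preimages near `x`, and injectivity allows only one.
-/
theorem HasLocalDegree.eq_one_of_injOn {f : X → Y} {x : X} {k : ℕ} (h : HasLocalDegree f x k)
    {N : Set X} (hN : N ∈ 𝓝 x) (hi : Set.InjOn f N) : k = 1 := by
  obtain ⟨U, -, -, hUN, -, -, V, -, -, ⟨y, hyV, hy⟩, hs⟩ := h.exists_local_fibers hN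
  obtain ⟨s, rfl, hsU⟩ := hs y hyV hy
  refine le_antisymm (Finset.card_le_one.2 fun a ha b hb => ?_) h.1
  have ha' : a ∈ U ∩ f ⁻¹' {y} := hsU ▸ ha
  have hb' : b ∈ U ∩ f ⁻¹' {y} := hsU ▸ hb
  exact hi (hUN ha'.1) (hUN hb'.1) (ha'.2.trans hb'.2.symm)

/-! ### The total degree -/

variable [CompactSpace X] {f : X → Y} {e : X → ℕ}

/-- A fibre is compact, and each of its points is isolated in it. -/
theorem finite_fiber_of_hasLocalDegree [T1Space Y] (he : ∀ x, HasLocalDegree f x (e x)) (y : Y) :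
    (f ⁻¹' {y}).Finite := by
  have hc : Continuous f := continuous_iff_continuousAt.2 fun x => (he x).continuousAt
  have hK : IsCompact (f ⁻¹' {y}) := (isClosed_singleton.preimage hc).isCompact
  choose U hUo hxU _ hU1 _ using fun x => (he x).exists_local_fibers univ_mem
  obtain ⟨t, ht, htK⟩ := hK.elim_nhds_subcover U fun x _ => (hUo x).mem_nhds (hxU x)
  refine t.finite_toSet.subset fun x hx => ?_
  obtain ⟨x', hx', hxx'⟩ := Set.mem_iUnion₂.1 (htK hx)
  have : x = x' := hU1 x' x hxx' (by rw [show f x = y from hx, show f x' = y from ht x' hx'])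
  rw [this]
  exact hx'

/-- The sum of the local degrees in a fibre does not depend on the fibre. -/
theorem sum_localDegree_fiber_const [T2Space X] [T2Space Y] [PreconnectedSpace Y]
    (he : ∀ x, HasLocalDegree f x (e x)) (y y' : Y) :
    ∑ᶠ x ∈ f ⁻¹' {y}, e x = ∑ᶠ x ∈ f ⁻¹' {y'}, e x := by
  classical
  have hc : Continuous f := continuous_iff_continuousAt.2 fun x => (he x).continuousAt
  suffices h : IsLocallyConstant fun y => ∑ᶠ x ∈ f ⁻¹' {y}, e x from
    h.apply_eq_of_preconnectedSpace y y'
  refine (IsLocallyConstant.iff_eventually_eq _).2 fun y₀ => ?_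
  have hfin := finite_fiber_of_hasLocalDegree he y₀
  obtain ⟨A, hA, hdisj⟩ := hfin.t2_separation
  choose U hUo hxU hUA hU1 hU2 V hVo hxV _ hV using
    fun x => (he x).exists_local_fibers ((hA x).2.mem_nhds (hA x).1)
  set S := f ⁻¹' {y₀} with hS
  -- Properness: the complement of the chosen neighbourhoods has compact image missing `y₀`, so
  -- nearby fibres cannot leave these neighbourhoods.
  have hmem : ∀ᶠ y in 𝓝 y₀, ∀ x, f x = y → x ∈ ⋃ x ∈ S, U x := by
    have hK : IsCompact (⋃ x ∈ S, U x)ᶜ :=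
      (isOpen_biUnion fun x _ => hUo x).isClosed_compl.isCompact
    have hy₀ : y₀ ∉ f '' (⋃ x ∈ S, U x)ᶜ := by
      rintro ⟨x, hx, hxy⟩
      exact hx (Set.mem_biUnion (show x ∈ S from hxy) (hxU x))
    filter_upwards [(hK.image hc).isClosed.isOpen_compl.mem_nhds hy₀] with y hy x hx
    by_contra hxU
    exact hy ⟨x, hxU, hx⟩
  have hVm : ∀ᶠ y in 𝓝 y₀, ∀ x ∈ S, y ∈ V x := by
    rw [eventually_all_finite hfin]
    intro x hx
    exact (hVo x).mem_nhds (by have := hxV x; rwa [show f x = y₀ from hx] at this)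
  filter_upwards [hmem, hVm] with y hy hyV
  have hdec : f ⁻¹' {y} = ⋃ x ∈ S, (U x ∩ f ⁻¹' {y}) := by
    ext x
    simp only [Set.mem_iUnion, Set.mem_inter_iff, exists_prop, Set.mem_preimage,
      Set.mem_singleton_iff]
    constructor
    · intro hx
      obtain ⟨x', hx', hxx'⟩ := Set.mem_iUnion₂.1 (hy x hx)
      exact ⟨x', hx', hxx', hx⟩
    · rintro ⟨-, -, -, h⟩
      exact h
  have hfinU : ∀ x, (U x ∩ f ⁻¹' {y}).Finite := fun x =>
    (finite_fiber_of_hasLocalDegree he y).subset Set.inter_subset_right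
  rw [hdec, finsum_mem_biUnion _ hfin fun x _ => hfinU x]
  · refine finsum_mem_congr rfl fun x hx => ?_
    have hxy₀ : f x = y₀ := hx
    -- Over `y₀` itself `U x` contributes the single point `x`; over any other nearby `y` it
    -- contributes `e x` points, each of local degree 1.
    by_cases hyy : y = y₀
    · have : U x ∩ f ⁻¹' {y} = {x} := by
        ext w
        simp only [Set.mem_inter_iff, Set.mem_preimage, Set.mem_singleton_iff]
        constructor
        · rintro ⟨hw, hwy⟩
          exact hU1 x w hw (by rw [hwy, hyy, hxy₀])
        · rintro rfl
          exact ⟨hxU _, by rw [hxy₀, hyy]⟩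
      rw [this, finsum_mem_singleton]
    · obtain ⟨s, hs, hsU⟩ := hV x y (hyV x hx) (by rwa [hxy₀])
      have h1 : ∀ w ∈ s, e w = 1 := by
        intro w hw
        have hw' : w ∈ U x ∩ f ⁻¹' {y} := hsU ▸ hw
        obtain ⟨N, hN, hNi⟩ := hU2 x w hw'.1 (by
          rintro rfl
          exact hyy (by rw [← hxy₀]; exact hw'.2.symm))
        exact (he w).eq_one_of_injOn hN hNi
      rw [← hsU, finsum_mem_coe_finset, Finset.sum_congr rfl h1]
      simp [hs]
  · intro a ha b hb hab
    exact (hdisj ha hb hab).mono (Set.inter_subset_left.trans (hUA a))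
      (Set.inter_subset_left.trans (hUA b))

end LocalDegree

/-! ### Local degrees of holomorphic maps -/

section Analytic

theorem HasLocalDegree.congr {X Y : Type*} [TopologicalSpace X] [TopologicalSpace Y]
    {f g : X → Y} {x : X} {k : ℕ} (h : HasLocalDegree f x k) (hfg : g =ᶠ[𝓝 x] f) :
    HasLocalDegree g x k := by
  obtain ⟨N, hN, hNo, hx⟩ := eventually_nhds_iff.1 hfg
  exact HasLocalDegree.comp_openPartialHomeomorph (OpenPartialHomeomorph.ofSet N hNo) (z := x) hx
    (fun w hw => hN w hw) h

theorem HasLocalDegree.isOpenEmbedding_comp {X Y Z : Type*} [TopologicalSpace X]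
    [TopologicalSpace Y] [TopologicalSpace Z] {f : X → Y} {x : X} {k : ℕ} {i : Y → Z}
    (hi : IsOpenEmbedding i) (h : HasLocalDegree f x k) : HasLocalDegree (i ∘ f) x k := by
  obtain ⟨hk, φ, ψ, hx, hx0, hy, hy0, hm, he⟩ := h
  have : Nonempty Y := ⟨f x⟩
  have hl : ∀ y, (hi.toOpenPartialHomeomorph i).symm (i y) = y := fun y =>
    (hi.toOpenPartialHomeomorph i).left_inv (x := y) (by simp)
  refine ⟨hk, φ, (hi.toOpenPartialHomeomorph i).symm.trans ψ, hx, hx0, ?_, ?_, ?_, ?_⟩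
  · rw [OpenPartialHomeomorph.trans_source]
    refine ⟨by simp, ?_⟩
    simpa [hl] using hy
  · simpa [hl] using hy0
  · intro w hw
    rw [OpenPartialHomeomorph.trans_source]
    refine ⟨by simp, ?_⟩
    simpa [hl] using hm hw
  · intro w hw
    simpa [hl] using he w hw

/-- Dividing by `u z₀` moves the value at `z₀` to 1, away from the branch cut of the complex power.
-/
theorem exists_analyticAt_pow_eq {u : ℂ → ℂ} {z₀ : ℂ} (hu : AnalyticAt ℂ u z₀) (hu0 : u z₀ ≠ 0)
    {k : ℕ} (hk : k ≠ 0) :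
    ∃ v : ℂ → ℂ, AnalyticAt ℂ v z₀ ∧ v z₀ ≠ 0 ∧ ∀ᶠ z in 𝓝 z₀, v z ^ k = u z := by
  have hs : u z₀ / u z₀ ∈ Complex.slitPlane := by
    rw [div_self hu0]
    exact Complex.one_mem_slitPlane
  have ha : AnalyticAt ℂ (fun z => (u z / u z₀) ^ ((k : ℂ)⁻¹)) z₀ :=
    (hu.div analyticAt_const hu0).cpow analyticAt_const hs
  have hp : ∀ z, (u z₀ ^ ((k : ℂ)⁻¹) * (u z / u z₀) ^ ((k : ℂ)⁻¹)) ^ k = u z := by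
    intro z
    rw [mul_pow, Complex.cpow_nat_inv_pow _ hk, Complex.cpow_nat_inv_pow _ hk, mul_div_cancel₀ _ hu0]
  refine ⟨fun z => u z₀ ^ ((k : ℂ)⁻¹) * (u z / u z₀) ^ ((k : ℂ)⁻¹), analyticAt_const.mul ha, ?_,
    Eventually.of_forall hp⟩
  intro h0
  have := hp z₀
  simp only at h0
  rw [h0, zero_pow hk] at this
  exact hu0 this.symm

/-- A holomorphic function taking a value with multiplicity `k` has local degree `k`. -/
theorem hasLocalDegree_of_eventually_eq_pow_mul {f u : ℂ → ℂ} {z₀ : ℂ} {k : ℕ} (hk : 1 ≤ k)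
    (hu : AnalyticAt ℂ u z₀) (hu0 : u z₀ ≠ 0)
    (hf : ∀ᶠ z in 𝓝 z₀, f z - f z₀ = (z - z₀) ^ k * u z) : HasLocalDegree f z₀ k := by
  obtain ⟨v, hv, hv0, hvu⟩ := exists_analyticAt_pow_eq hu hu0 (k := k) (by omega)
  -- With `v ^ k = u`, this function is the required chart: its `k`-th power is `f - f z₀`, and its
  -- derivative at `z₀` is nonzero.
  have hd : HasStrictDerivAt (fun z => (z - z₀) * v z) (v z₀) z₀ := by
    have h1 : HasStrictDerivAt (fun z : ℂ => z - z₀) 1 z₀ := (hasStrictDerivAt_id z₀).sub_const z₀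
    simpa [Pi.mul_def] using h1.mul hv.hasStrictDerivAt
  let e := (hd.hasStrictFDerivAt_equiv hv0).toOpenPartialHomeomorph
  have hez : z₀ ∈ e.source := (hd.hasStrictFDerivAt_equiv hv0).mem_toOpenPartialHomeomorph_source
  have hec : ∀ z, e z = (z - z₀) * v z := fun z =>
    congrFun (hd.hasStrictFDerivAt_equiv hv0).toOpenPartialHomeomorph_coe z
  obtain ⟨N, hN, hNo, hzN⟩ := eventually_nhds_iff.1 (hf.and hvu)
  refine ⟨hk, e.restrOpen N hNo, (Homeomorph.addRight (-f z₀)).toOpenPartialHomeomorph, ?_, ?_, ?_,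
    ?_, ?_, ?_⟩
  · rw [OpenPartialHomeomorph.restrOpen_source]
    exact ⟨hez, hzN⟩
  · simp [hec]
  · simp
  · simp
  · intro w _
    simp
  · intro w hw
    rw [OpenPartialHomeomorph.restrOpen_source] at hw
    obtain ⟨h1, h2⟩ := hN w hw.2
    simp [hec, mul_pow, h2, ← sub_eq_add_neg, h1]

/-! ### Inversion on the Riemann sphere -/

/-- The involution `z ↦ 1 / z` of the Riemann sphere. -/
noncomputable def sphereInv (x : OnePoint ℂ) : OnePoint ℂ :=
  x.elim ((0 : ℂ) : OnePoint ℂ) fun z => open scoped Classical in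
    if z = 0 then OnePoint.infty else ((z⁻¹ : ℂ) : OnePoint ℂ)

theorem sphereInv_infty : sphereInv OnePoint.infty = ((0 : ℂ) : OnePoint ℂ) := rfl

theorem sphereInv_zero : sphereInv ((0 : ℂ) : OnePoint ℂ) = OnePoint.infty := by
  simp [sphereInv]

theorem sphereInv_coe {z : ℂ} (hz : z ≠ 0) :
    sphereInv (z : OnePoint ℂ) = ((z⁻¹ : ℂ) : OnePoint ℂ) := by
  simp [sphereInv, hz]

theorem sphereInv_sphereInv (x : OnePoint ℂ) : sphereInv (sphereInv x) = x := by
  induction x using OnePoint.rec with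
  | infty => rw [sphereInv_infty, sphereInv_zero]
  | coe z =>
    by_cases hz : z = 0
    · rw [hz, sphereInv_zero, sphereInv_infty]
    · rw [sphereInv_coe hz, sphereInv_coe (inv_ne_zero hz), inv_inv]

theorem continuous_sphereInv : Continuous sphereInv := by
  rw [OnePoint.continuous_iff]
  constructor
  · rw [sphereInv_infty, coclosedCompact_eq_cocompact, ← Metric.cobounded_eq_cocompact]
    have h1 : Tendsto (fun z : ℂ => ((z⁻¹ : ℂ) : OnePoint ℂ)) (Bornology.cobounded ℂ)
        (𝓝 ((0 : ℂ) : OnePoint ℂ)) :=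
      (OnePoint.continuous_coe.tendsto 0).comp tendsto_inv₀_cobounded
    refine h1.congr' ?_
    filter_upwards [Bornology.eventually_ne_cobounded (0 : ℂ)] with z hz
    rw [sphereInv_coe hz]
  · rw [continuous_iff_continuousAt]
    intro z
    by_cases hz : z = 0
    · subst hz
      rw [ContinuousAt, sphereInv_zero, ← nhdsNE_sup_pure, tendsto_sup]
      constructor
      · have h1 : Tendsto (fun z : ℂ => ((z⁻¹ : ℂ) : OnePoint ℂ)) (𝓝[≠] 0)
            (𝓝 (OnePoint.infty : OnePoint ℂ)) := by
          have h2 := OnePoint.tendsto_coe_infty (X := ℂ)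
          rw [coclosedCompact_eq_cocompact, ← Metric.cobounded_eq_cocompact] at h2
          exact h2.comp tendsto_inv₀_nhdsNE_zero
        refine h1.congr' ?_
        filter_upwards [self_mem_nhdsWithin] with z hz
        rw [sphereInv_coe hz]
      · rw [tendsto_pure_left]
        intro s hs
        rw [sphereInv_zero]
        exact mem_of_mem_nhds hs
    · have h1 : ContinuousAt (fun z : ℂ => ((z⁻¹ : ℂ) : OnePoint ℂ)) z :=
        OnePoint.continuous_coe.continuousAt.comp (continuousAt_inv₀ hz)
      refine h1.congr ?_
      filter_upwards [isOpen_ne.mem_nhds hz] with w hw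
      rw [sphereInv_coe hw]

/-- `sphereInv` as a homeomorphism. -/
noncomputable def sphereInvHomeo : OnePoint ℂ ≃ₜ OnePoint ℂ where
  toFun := sphereInv
  invFun := sphereInv
  left_inv := sphereInv_sphereInv
  right_inv := sphereInv_sphereInv
  continuous_toFun := continuous_sphereInv
  continuous_invFun := continuous_sphereInv

end Analytic

/-! ### Symmetric elliptic functions as maps to the sphere -/

section Elliptic

/-- The map to the Riemann sphere defined by a function with poles at the lattice points. -/
noncomputable def toRiemannSphere (L : PeriodPair) (g : ℂ → ℂ) (z : ℂ) : OnePoint ℂ :=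
  open scoped Classical in if z ∈ L.lattice then OnePoint.infty else (g z : OnePoint ℂ)

/-- `g` is an elliptic function whose only pole, modulo periods, is at `0` and has order `n`, and
which is invariant under the rotation of order `n` with factor `α`. -/
structure IsSymmetricElliptic (L : PeriodPair) (n : ℕ) (α : ℂ) (g : ℂ → ℂ) : Prop where
  pos : 1 ≤ n
  primitive : IsPrimitiveRoot α n
  mul_mem : ∀ z, α * z ∈ L.lattice ↔ z ∈ L.lattice
  periodic : ∀ z, ∀ l ∈ L.lattice, g (z + l) = g z
  analytic : ∀ z, z ∉ L.lattice → AnalyticAt ℂ g z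
  meromorphic : MeromorphicAt g 0
  order : meromorphicOrderAt g 0 = ((-n : ℤ) : WithTop ℤ)
  symm : ∀ z, g (α * z) = g z

namespace IsSymmetricElliptic

variable {L : PeriodPair} {n : ℕ} {α : ℂ} {g : ℂ → ℂ}

theorem symm_pow (h : IsSymmetricElliptic L n α g) (j : ℕ) (z : ℂ) : g (α ^ j * z) = g z := by
  induction j with
  | zero => simp
  | succ j ih => rw [pow_succ', mul_assoc, h.symm, ih]

theorem exists_inv_eq (h : IsSymmetricElliptic L n α g) : ∃ u : ℂ → ℂ, AnalyticAt ℂ u 0 ∧ u 0 ≠ 0 ∧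
    ∀ᶠ z in 𝓝[≠] 0, (g z)⁻¹ = z ^ n * u z := by
  have h1 : meromorphicOrderAt g⁻¹ 0 = ((n : ℤ) : WithTop ℤ) := by
    rw [meromorphicOrderAt_inv, h.order]
    simp
  obtain ⟨u, hu, hu0, he⟩ := (meromorphicOrderAt_eq_int_iff h.meromorphic.inv).1 h1
  refine ⟨u, hu, hu0, ?_⟩
  filter_upwards [he] with z hz
  simpa using hz

/-- The reciprocal of `g`, set to 0 on the lattice, has a zero of order `n` at `z`; inversion of the
sphere carries it to the map in question. -/
theorem hasLocalDegree_of_mem (h : IsSymmetricElliptic L n α g) {z : ℂ} (hz : z ∈ L.lattice) :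
    HasLocalDegree (toRiemannSphere L g) z n := by
  classical
  obtain ⟨u, hu, hu0, he⟩ := h.exists_inv_eq
  let q : ℂ → ℂ := fun w => if w ∈ L.lattice then 0 else (g w)⁻¹
  have hq : HasLocalDegree q z n := by
    refine hasLocalDegree_of_eventually_eq_pow_mul (u := fun w => u (w - z)) h.pos ?_ ?_ ?_
    · have : AnalyticAt ℂ (fun w : ℂ => w - z) z := by fun_prop
      exact AnalyticAt.fun_comp (by simpa using hu) this
    · simpa using hu0
    · have hqz : q z = 0 := if_pos hz
      have h1 : ∀ᶠ w in 𝓝 (0 : ℂ), w ≠ 0 → (g w)⁻¹ = w ^ n * u w ∧ w ∉ L.lattice := by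
        have h2 := L.compl_lattice_sdiff_singleton_mem_nhds 0
        rw [eventually_nhdsWithin_iff] at he
        filter_upwards [he, h2] with w hw1 hw2 hw0
        exact ⟨hw1 hw0, fun hw => hw2 ⟨hw, hw0⟩⟩
      have ht : Tendsto (fun w : ℂ => w - z) (𝓝 z) (𝓝 0) := by
        have : ContinuousAt (fun w : ℂ => w - z) z := by fun_prop
        simpa [ContinuousAt] using this
      filter_upwards [ht.eventually h1] with w hw
      rw [hqz, sub_zero]
      by_cases hwz : w = z
      · rw [hwz, hqz, sub_self, zero_pow (by have := h.pos; omega), zero_mul]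
      · obtain ⟨h3, h4⟩ := hw (sub_ne_zero.2 hwz)
        have h5 : w ∉ L.lattice := fun h5 => h4 (sub_mem h5 hz)
        rw [← h3, show q w = (g w)⁻¹ from if_neg h5, sub_eq_add_neg, h.periodic _ _ (neg_mem hz)]
  have hI := (hq.isOpenEmbedding_comp OnePoint.isOpenEmbedding_coe).homeomorph_comp sphereInvHomeo
  refine hI.congr ?_
  have h2 := L.compl_lattice_sdiff_singleton_mem_nhds z
  have h1 : ∀ᶠ w in 𝓝 (0 : ℂ), w ≠ 0 → g w ≠ 0 := by
    rw [eventually_nhdsWithin_iff] at he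
    filter_upwards [he, hu.continuousAt.eventually_ne hu0] with w hw1 hw2 hw0 hg
    have := hw1 hw0
    rw [hg, inv_zero] at this
    exact mul_ne_zero (pow_ne_zero n hw0) hw2 this.symm
  have ht : Tendsto (fun w : ℂ => w - z) (𝓝 z) (𝓝 0) := by
    have : ContinuousAt (fun w : ℂ => w - z) z := by fun_prop
    simpa [ContinuousAt] using this
  filter_upwards [h2, ht.eventually h1] with w hw hw1
  change toRiemannSphere L g w = sphereInv (q w : OnePoint ℂ)
  by_cases hwL : w ∈ L.lattice
  · rw [toRiemannSphere, if_pos hwL, show q w = 0 from if_pos hwL, sphereInv_zero]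
  · have hwz : w ≠ z := fun hwz => hwL (hwz ▸ hz)
    have hg := hw1 (sub_ne_zero.2 hwz)
    rw [sub_eq_add_neg, h.periodic _ _ (neg_mem hz)] at hg
    rw [toRiemannSphere, if_neg hwL, show q w = (g w)⁻¹ from if_neg hwL,
      sphereInv_coe (inv_ne_zero hg), inv_inv]

/-- The complement of the countable lattice is connected, so by the identity theorem local constancy
would spread up to the pole at 0. -/
theorem not_eventually_const (h : IsSymmetricElliptic L n α g) {z : ℂ} (hz : z ∉ L.lattice) : ¬ ∀ᶠ w in 𝓝 z, g w - g z = 0 := by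
  intro hc
  have hcount : (L.lattice : Set ℂ).Countable := by
    have : Countable L.lattice := L.latticeEquivProd.injective.countable
    exact Set.to_countable _
  have hconn : IsPreconnected ((L.lattice : Set ℂ)ᶜ) :=
    (hcount.isConnected_compl_of_one_lt_rank (by
      rw [Complex.rank_real_complex]; norm_num)).isPreconnected
  have heq : Set.EqOn g (fun _ => g z) ((L.lattice : Set ℂ)ᶜ) :=
    AnalyticOnNhd.eqOn_of_preconnected_of_eventuallyEq (fun w hw => h.analytic w hw)
      (fun w _ => analyticAt_const) hconn hz (by
        filter_upwards [hc] with w hw using sub_eq_zero.1 hw)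
  obtain ⟨u, hu, hu0, he⟩ := h.exists_inv_eq
  have hL : ∀ᶠ w in 𝓝[≠] (0 : ℂ), w ∉ L.lattice := by
    rw [eventually_nhdsWithin_iff]
    filter_upwards [L.compl_lattice_sdiff_singleton_mem_nhds 0] with w hw hw0 hwL
    exact hw ⟨hwL, hw0⟩
  have he' : ∀ᶠ w in 𝓝[≠] (0 : ℂ), w ^ n * u w = (g z)⁻¹ := by
    filter_upwards [he, hL] with w hw hwL
    rw [← hw, heq hwL]
  have ht : Tendsto (fun w => w ^ n * u w) (𝓝[≠] 0) (𝓝 0) := by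
    have hca : ContinuousAt (fun w => w ^ n * u w) 0 :=
      (continuousAt_id.pow n).mul hu.continuousAt
    have := hca.tendsto
    simp only [zero_pow (show n ≠ 0 by have := h.pos; omega), zero_mul] at this
    exact this.mono_left nhdsWithin_le_nhds
  -- This alone is no contradiction, since `0⁻¹ = 0`; the contradiction is that `w ^ n * u w` does
  -- not vanish for small `w ≠ 0`.
  have hg0 : (g z)⁻¹ = 0 :=
    tendsto_nhds_unique (tendsto_const_nhds.congr' (he'.mono fun w hw => hw.symm)) ht
  have hu' : ∀ᶠ w in 𝓝[≠] (0 : ℂ), u w ≠ 0 :=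
    (hu.continuousAt.eventually_ne hu0).filter_mono nhdsWithin_le_nhds
  obtain ⟨w, hw, hwu, hw0⟩ := (he'.and (hu'.and self_mem_nhdsWithin)).exists
  rw [hg0] at hw
  exact mul_ne_zero (pow_ne_zero n hw0) hwu hw

/-- Here `k` is the vanishing order of `g - g z` at `z`. If `α ^ j` fixes `z` modulo periods, then
`g (z + t)` is unchanged under `t ↦ α ^ j * t`; comparing the leading terms `u z * t ^ k` gives `α ^
(j * k) = 1`. -/
theorem exists_hasLocalDegree_of_notMem (h : IsSymmetricElliptic L n α g) {z : ℂ} (hz : z ∉ L.lattice) :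
    ∃ k, HasLocalDegree (toRiemannSphere L g) z k ∧
      ∀ j : ℕ, α ^ j * z - z ∈ L.lattice → n ∣ j * k := by
  have han : AnalyticAt ℂ (fun w => g w - g z) z := (h.analytic z hz).sub analyticAt_const
  have hord : analyticOrderAt (fun w => g w - g z) z ≠ ⊤ := by
    rw [Ne, analyticOrderAt_eq_top]
    exact h.not_eventually_const hz
  obtain ⟨u, hu, hu0, he⟩ := han.analyticOrderAt_ne_top.1 hord
  set k := analyticOrderNatAt (fun w => g w - g z) z with hkdef
  simp only [smul_eq_mul] at he
  have hk : 1 ≤ k := by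
    by_contra! hk
    have hk0 : k = 0 := by omega
    have := he.self_of_nhds
    rw [hk0] at this
    simp only [sub_self, pow_zero, one_mul] at this
    exact hu0 this.symm
  refine ⟨k, ?_, fun j hj => ?_⟩
  · have h1 := hasLocalDegree_of_eventually_eq_pow_mul hk hu hu0 he
    refine (h1.isOpenEmbedding_comp OnePoint.isOpenEmbedding_coe).congr ?_
    filter_upwards [L.isClosed_lattice.isOpen_compl.mem_nhds hz] with w hw
    exact if_neg hw
  · rw [mul_comm, mul_comm k j]
    apply h.primitive.dvd_of_pow_eq_one
    have hα : α ^ j ≠ 0 := pow_ne_zero j (h.primitive.ne_zero (by have := h.pos; omega))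
    have hrot : ∀ t, g (z + α ^ j * t) = g (z + t) := by
      intro t
      rw [← h.symm_pow j (z + t), mul_add, ← h.periodic _ _ hj]
      congr 1
      ring
    have ht : Tendsto (fun t : ℂ => z + t) (𝓝 0) (𝓝 z) := by
      have : ContinuousAt (fun t : ℂ => z + t) 0 := by fun_prop
      simpa [ContinuousAt] using this
    have ht' : Tendsto (fun t : ℂ => z + α ^ j * t) (𝓝 0) (𝓝 z) := by
      have : ContinuousAt (fun t : ℂ => z + α ^ j * t) 0 := by fun_prop
      simpa [ContinuousAt] using this
    have hev : ∀ᶠ t in 𝓝[≠] (0 : ℂ), α ^ (j * k) * u (z + α ^ j * t) = u (z + t) := by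
      rw [eventually_nhdsWithin_iff]
      filter_upwards [ht.eventually he, ht'.eventually he] with t h1 h2 ht0
      rw [hrot t, h1] at h2
      have ht0' : t ^ k ≠ 0 := pow_ne_zero k ht0
      simp only [add_sub_cancel_left, mul_pow, ← pow_mul] at h2
      apply mul_left_cancel₀ ht0'
      rw [h2]
      ring
    have hc1 : Tendsto (fun t => α ^ (j * k) * u (z + α ^ j * t)) (𝓝[≠] 0)
        (𝓝 (α ^ (j * k) * u z)) :=
      ((hu.continuousAt.tendsto.comp ht').const_mul _).mono_left nhdsWithin_le_nhds
    have hc2 : Tendsto (fun t => u (z + t)) (𝓝[≠] 0) (𝓝 (u z)) :=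
      (hu.continuousAt.tendsto.comp ht).mono_left nhdsWithin_le_nhds
    have := tendsto_nhds_unique (hc1.congr' hev) hc2
    exact mul_right_cancel₀ hu0 (by rw [this, one_mul])

theorem exists_hasLocalDegree (h : IsSymmetricElliptic L n α g) (z : ℂ) :
    ∃ k, HasLocalDegree (toRiemannSphere L g) z k ∧ (z ∈ L.lattice → k = n) ∧
      ∀ j : ℕ, α ^ j * z - z ∈ L.lattice → n ∣ j * k := by
  by_cases hz : z ∈ L.lattice
  · exact ⟨n, h.hasLocalDegree_of_mem hz, fun _ => rfl, fun j _ => dvd_mul_left n j⟩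
  · obtain ⟨k, hk, hj⟩ := h.exists_hasLocalDegree_of_notMem hz
    exact ⟨k, hk, fun h' => absurd h' hz, hj⟩

theorem toRiemannSphere_add (h : IsSymmetricElliptic L n α g) (z : ℂ) {l : ℂ} (hl : l ∈ L.lattice) :
    toRiemannSphere L g (z + l) = toRiemannSphere L g z := by
  rw [toRiemannSphere, toRiemannSphere, h.periodic z l hl]
  congr 1
  exact propext ((Submodule.add_mem_iff_left _ hl))

theorem toRiemannSphere_mul (h : IsSymmetricElliptic L n α g) (z : ℂ) : toRiemannSphere L g (α * z) = toRiemannSphere L g z := by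
  rw [toRiemannSphere, toRiemannSphere, h.symm z]
  congr 1
  exact propext (h.mul_mem z)

end IsSymmetricElliptic

theorem toRiemannSphere_eq_infty {L : PeriodPair} {g : ℂ → ℂ} {z : ℂ} :
    toRiemannSphere L g z = OnePoint.infty ↔ z ∈ L.lattice := by
  rw [toRiemannSphere]
  split_ifs with hz
  · simp [hz]
  · simp [hz]

end Elliptic

/-! ### The torus and its self-coverings -/

section Torus

/-- The torus `ℝ/ℤ × ℝ/ℤ`. -/
abbrev Torus : Type := UnitAddCircle × UnitAddCircle

/-- The universal covering of the torus. -/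
def torusProj (v : ℝ × ℝ) : Torus := ((v.1 : UnitAddCircle), (v.2 : UnitAddCircle))

theorem torusProj_surjective : Function.Surjective torusProj := by
  rintro ⟨a, b⟩
  induction a using QuotientAddGroup.induction_on with
  | H a =>
    induction b using QuotientAddGroup.induction_on with
    | H b => exact ⟨(a, b), rfl⟩

theorem isLocalHomeomorph_torusProj : IsLocalHomeomorph torusProj := by
  rintro ⟨a, b⟩
  obtain ⟨e₁, h₁, he₁⟩ := AddCircle.isLocalHomeomorph_coe (1 : ℝ) a
  obtain ⟨e₂, h₂, he₂⟩ := AddCircle.isLocalHomeomorph_coe (1 : ℝ) b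
  refine ⟨e₁.prod e₂, ⟨h₁, h₂⟩, ?_⟩
  funext v
  have h1 := congrFun he₁ v.1
  have h2 := congrFun he₂ v.2
  exact Prod.ext h1 h2

theorem hasLocalDegree_id_torus (x : Torus) : HasLocalDegree (id : Torus → Torus) x 1 := by
  obtain ⟨v, rfl⟩ := torusProj_surjective x
  obtain ⟨e, hv, he⟩ := isLocalHomeomorph_torusProj v
  rw [he]
  refine hasLocalDegree_id_of_chart
    (e.symm.trans Complex.equivRealProdCLM.symm.toHomeomorph.toOpenPartialHomeomorph) ?_
  rw [OpenPartialHomeomorph.trans_source]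
  exact ⟨e.map_source hv, by simp⟩

/-- The `k`-fold self-covering of the torus. -/
def torusCover (k : ℕ) (x : Torus) : Torus := (k • x.1, x.2)

/-- The lift of `torusCover k` to the universal covering. -/
noncomputable def torusCoverLift (k : ℕ) (hk : 1 ≤ k) : ℝ × ℝ ≃ₜ ℝ × ℝ :=
  (Homeomorph.mulLeft₀ (k : ℝ) (by positivity)).prodCongr (Homeomorph.refl ℝ)

theorem torusProj_torusCoverLift {k : ℕ} (hk : 1 ≤ k) (v : ℝ × ℝ) :
    torusProj (torusCoverLift k hk v) = torusCover k (torusProj v) := by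
  simp [torusProj, torusCoverLift, torusCover, ← nsmul_eq_mul]

theorem torusCover_surjective {k : ℕ} (hk : 1 ≤ k) : Function.Surjective (torusCover k) := by
  intro x
  obtain ⟨v, rfl⟩ := torusProj_surjective x
  refine ⟨torusProj ((torusCoverLift k hk).symm v), ?_⟩
  rw [← torusProj_torusCoverLift hk, Homeomorph.apply_symm_apply]

/-- On the universal covering `torusCover k` becomes a linear homeomorphism, which does not affect
local degrees. -/
theorem hasLocalDegree_comp_torusCover {Y : Type*} [TopologicalSpace Y] {f : Torus → Y} {k : ℕ}
    (hk : 1 ≤ k) {x : Torus} {m : ℕ} (h : HasLocalDegree f (torusCover k x) m) :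
    HasLocalDegree (f ∘ torusCover k) x m := by
  obtain ⟨v, rfl⟩ := torusProj_surjective x
  rw [← hasLocalDegree_comp_isLocalHomeomorph isLocalHomeomorph_torusProj]
  have : (f ∘ torusCover k) ∘ torusProj = (f ∘ torusProj) ∘ torusCoverLift k hk := by
    funext v
    simp [torusProj_torusCoverLift]
  rw [this, hasLocalDegree_comp_isLocalHomeomorph (torusCoverLift k hk).isLocalHomeomorph,
    hasLocalDegree_comp_isLocalHomeomorph isLocalHomeomorph_torusProj, torusProj_torusCoverLift]
  exact h

theorem exists_fiber_torusCover {k : ℕ} (hk : 1 ≤ k) (y : Torus) :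
    ∃ s : Finset Torus, s.card = k ∧ ∀ x, x ∈ s ↔ torusCover k x = y := by
  classical
  obtain ⟨x₀, rfl⟩ := torusCover_surjective hk y
  -- The fibre is a translate of the `k`-torsion of the first circle; the factor 1 is the period,
  -- kept to match `AddCircle.nsmul_eq_zero_iff`.
  refine ⟨(Finset.range k).image fun m : ℕ =>
    (x₀ + ((((m : ℝ) / k * 1 : ℝ) : UnitAddCircle), 0) : Torus), ?_, fun x => ?_⟩
  · rw [Finset.card_image_of_injOn, Finset.card_range]
    intro a ha b hb hab
    have h1 : (((a : ℝ) / k * 1 : ℝ) : UnitAddCircle) = (((b : ℝ) / k * 1 : ℝ) : UnitAddCircle) :=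
      congrArg Prod.fst (add_left_cancel hab)
    have hk0 : (0 : ℝ) < k := by positivity
    have hI : ∀ c ∈ Finset.range k, ((c : ℝ) / k * 1) ∈ Set.Ico (0 : ℝ) (0 + 1) := by
      intro c hc
      rw [mul_one, zero_add]
      refine ⟨by positivity, ?_⟩
      rw [div_lt_one hk0]
      exact_mod_cast Finset.mem_range.1 hc
    rw [AddCircle.coe_eq_coe_iff_of_mem_Ico (hI a ha) (hI b hb)] at h1
    have : (a : ℝ) = b := by
      field_simp at h1
      exact h1
    exact_mod_cast this
  · simp only [Finset.mem_image, Finset.mem_range]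
    have key : torusCover k x = torusCover k x₀ ↔ k • (x.1 - x₀.1) = 0 ∧ x.2 = x₀.2 := by
      rw [torusCover, torusCover, Prod.mk.injEq, smul_sub, sub_eq_zero]
    rw [key, AddCircle.nsmul_eq_zero_iff (by omega)]
    constructor
    · rintro ⟨m, hm, rfl⟩
      exact ⟨⟨m, hm, by simp⟩, by simp⟩
    · rintro ⟨⟨m, hm, h1⟩, h2⟩
      refine ⟨m, hm, Prod.ext ?_ ?_⟩
      · rw [Prod.fst_add, h1, add_sub_cancel]
      · simp [h2]

theorem isBranchedCoverWith_torusCover {k : ℕ} (hk : 1 ≤ k) :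
    IsBranchedCoverWith (torusCover k) k 0 := by
  choose F hF hFm using exists_fiber_torusCover hk
  refine ⟨fun _ => 1, F, ∅, fun x => ?_, fun y x => hFm y x, fun y => ?_, fun y _ => hF y, by simp⟩
  · exact hasLocalDegree_comp_torusCover hk (hasLocalDegree_id_torus _)
  · simp

end Torus

/-! ### Fibres of invariant maps -/

/-- Fibres of a map whose total degree is the order of a symmetry and whose local degrees are at
least the orders of the stabilizers are single orbits. -/
theorem fiber_eq_orbit {X Y : Type*} [TopologicalSpace X] [TopologicalSpace Y] [CompactSpace X]
    [T2Space X] [T2Space Y] [PreconnectedSpace Y] {f : X → Y} {e : X → ℕ} {ρ : X → X} {n : ℕ}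
    (hn : 1 ≤ n) (he : ∀ x, HasLocalDegree f x (e x)) (hρ : ∀ x, f (ρ x) = f x)
    (hper : ∀ x, ρ^[n] x = x) (hdvd : ∀ x j, ρ^[j] x = x → n ∣ j * e x)
    {x₀ : X} (h0 : ∀ x, f x = f x₀ → x = x₀) (h0n : e x₀ = n) :
    Function.Surjective f ∧ ∀ p, ∃ s : Finset X, s.card = Function.minimalPeriod ρ p ∧
      (∀ q, q ∈ s ↔ f q = f p) ∧ (∀ q, q ∈ s ↔ ∃ i, ρ^[i] p = q) ∧
      ∀ q ∈ s, e q * Function.minimalPeriod ρ p = n := by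
  classical
  have hit : ∀ x i, f (ρ^[i] x) = f x := by
    intro x i
    induction i with
    | zero => rfl
    | succ i ih => rw [Function.iterate_succ_apply', hρ, ih]
  have htot : ∀ y, ∑ᶠ x ∈ f ⁻¹' {y}, e x = n := by
    intro y
    rw [sum_localDegree_fiber_const he y (f x₀)]
    have : f ⁻¹' {f x₀} = {x₀} := by
      ext x
      exact ⟨fun hx => h0 x hx, fun hx => congrArg f hx⟩
    rw [this, finsum_mem_singleton, h0n]
  refine ⟨fun y => ?_, fun p => ?_⟩
  · by_contra! hy
    have h1 := htot y
    rw [show f ⁻¹' {y} = ∅ from Set.eq_empty_of_forall_notMem fun x hx => hy x hx,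
      finsum_mem_empty] at h1
    omega
  have hpp : ∀ q, Function.IsPeriodicPt ρ n q := hper
  have hmem : p ∈ Function.periodicPts ρ := ⟨n, hn, hpp p⟩
  set m := Function.minimalPeriod ρ p with hm
  have hm0 : 0 < m := (hpp p).minimalPeriod_pos hn
  let O : Finset X := (Finset.range m).image fun i => ρ^[i] p
  have hOcard : O.card = m := by
    rw [Finset.card_image_of_injOn, Finset.card_range]
    intro a ha b hb hab
    exact Function.iterate_injOn_Iio_minimalPeriod (f := ρ) (x := p) (by simpa using ha)
      (by simpa using hb) hab
  have hOmem : ∀ q, q ∈ O ↔ ∃ i, ρ^[i] p = q := by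
    intro q
    simp only [O, Finset.mem_image, Finset.mem_range]
    constructor
    · rintro ⟨i, -, h⟩
      exact ⟨i, h⟩
    · rintro ⟨i, rfl⟩
      exact ⟨i % m, Nat.mod_lt _ hm0, Function.iterate_mod_minimalPeriod_eq⟩
  -- All points of the orbit have the same minimal period `m`, so the divisibility hypothesis
  -- applies to each with `j = m`.
  have hOe : ∀ q ∈ O, n ≤ m * e q := by
    intro q hq
    obtain ⟨i, rfl⟩ := (hOmem q).1 hq
    refine Nat.le_of_dvd (Nat.mul_pos hm0 (he _).1) (hdvd _ _ ?_)
    rw [hm, ← Function.minimalPeriod_apply_iterate hmem i, Function.iterate_minimalPeriod]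
  let S : Finset X := (finite_fiber_of_hasLocalDegree he (f p)).toFinset
  have hSmem : ∀ q, q ∈ S ↔ f q = f p := by
    intro q
    simp [S]
  have hOS : O ⊆ S := by
    intro q hq
    obtain ⟨i, rfl⟩ := (hOmem q).1 hq
    exact (hSmem _).2 (hit p i)
  have hsum : ∑ x ∈ S, e x = n := by
    rw [← htot (f p), ← finsum_mem_coe_finset]
    simp [S]
  have hsum' : ∑ x ∈ S, m * e x = m * n := by rw [← Finset.mul_sum, hsum]
  have hOle : m * n ≤ ∑ x ∈ O, m * e x := by
    calc m * n = ∑ x ∈ O, n := by simp [hOcard]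
      _ ≤ _ := Finset.sum_le_sum hOe
  -- The orbit contributes at least `m * n` to a fibre sum equal to `m * n`: nothing is left outside
  -- it, and each of the inequalities in `hOe` is an equality.
  have hsd := Finset.sum_sdiff hOS (f := fun x => m * e x)
  have hz : ∑ x ∈ S \ O, m * e x = 0 := by omega
  have hSO : S = O := by
    refine (Finset.Subset.antisymm hOS fun q hq => ?_).symm
    by_contra hqO
    have := (Finset.sum_eq_zero_iff.1 hz) q (Finset.mem_sdiff.2 ⟨hq, hqO⟩)
    have := Nat.mul_pos hm0 (he q).1
    omega
  refine ⟨O, hOcard, hSO ▸ hSmem, hOmem, fun q hq => ?_⟩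
  have heq : ∑ x ∈ O, n = ∑ x ∈ O, m * e x := by
    refine le_antisymm (Finset.sum_le_sum hOe) ?_
    rw [Finset.sum_const, hOcard, smul_eq_mul, ← hSO, hsum']
  rw [mul_comm]
  exact ((Finset.sum_eq_sum_iff_of_le hOe).1 heq q hq).symm

/-! ### Maps from the torus to the sphere -/

/-- Real coordinates with respect to a pair of periods. -/
noncomputable def periodCoords (L : PeriodPair) : ℝ × ℝ ≃ₜ ℂ :=
  Homeomorph.finTwoArrow.symm.trans
    L.basis.equivFun.symm.toContinuousLinearEquiv.toHomeomorph

theorem periodCoords_apply (L : PeriodPair) (v : ℝ × ℝ) :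
    periodCoords L v = v.1 * L.ω₁ + v.2 * L.ω₂ := by
  change L.basis.equivFun.symm ![v.1, v.2] = _
  rw [Module.Basis.equivFun_symm_apply]
  simp

/-- Identifies the fixed model `ℝ/ℤ × ℝ/ℤ` with the quotient of `ℂ` by any given lattice. -/
theorem torusProj_eq_iff (L : PeriodPair) (v w : ℝ × ℝ) :
    torusProj v = torusProj w ↔ periodCoords L v - periodCoords L w ∈ L.lattice := by
  have h1 : ∀ a b : ℝ, (a : UnitAddCircle) = b ↔ ∃ m : ℤ, (m : ℝ) = a - b := by
    intro a b
    rw [← sub_eq_zero, ← AddCircle.coe_sub, AddCircle.coe_eq_zero_iff]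
    simp
  rw [torusProj, torusProj, Prod.mk.injEq, h1, h1, PeriodPair.mem_lattice]
  have h2 : periodCoords L v - periodCoords L w =
      periodCoords L (v.1 - w.1, v.2 - w.2) := by
    simp only [periodCoords_apply]
    push_cast
    ring
  constructor
  · rintro ⟨⟨m, hm⟩, ⟨n, hn⟩⟩
    refine ⟨m, n, ?_⟩
    rw [h2, periodCoords_apply, ← hm, ← hn]
    simp
  · rintro ⟨m, n, h⟩
    have h3 : periodCoords L ((m : ℝ), (n : ℝ)) = periodCoords L (v.1 - w.1, v.2 - w.2) := by
      rw [← h2, ← h, periodCoords_apply]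
      simp
    have h4 := (periodCoords L).injective h3
    exact ⟨⟨m, congrArg Prod.fst h4⟩, ⟨n, congrArg Prod.snd h4⟩⟩

/-- A symmetric elliptic function defines a map from the torus to the Riemann sphere whose fibres
are the orbits of the symmetry. -/
theorem IsSymmetricElliptic.exists_map {L : PeriodPair} {n : ℕ} {α : ℂ} {g : ℂ → ℂ}
    (h : IsSymmetricElliptic L n α g) {ρ : Torus → Torus}
    (hρ : ∀ v, ∃ w, torusProj w = ρ (torusProj v) ∧ periodCoords L w = α * periodCoords L v) :
    ∃ (f : Torus → OnePoint ℂ) (e : Torus → ℕ), (∀ x, HasLocalDegree f x (e x)) ∧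
      Function.Surjective f ∧ ∀ p, ∃ s : Finset Torus, s.card = Function.minimalPeriod ρ p ∧
      (∀ q, q ∈ s ↔ f q = f p) ∧ (∀ q, q ∈ s ↔ ∃ i, ρ^[i] p = q) ∧
      ∀ q ∈ s, e q * Function.minimalPeriod ρ p = n := by
  obtain ⟨σ, hσ⟩ := torusProj_surjective.hasRightInverse
  -- The section `σ` is arbitrary; periodicity makes the map independent of it, as `hf` records.
  let f : Torus → OnePoint ℂ := fun x => toRiemannSphere L g (periodCoords L (σ x))
  have hf : ∀ v, f (torusProj v) = toRiemannSphere L g (periodCoords L v) := by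
    intro v
    have h1 := (torusProj_eq_iff L (σ (torusProj v)) v).1 (hσ _)
    have h2 := h.toRiemannSphere_add (periodCoords L v) h1
    rw [add_sub_cancel] at h2
    exact h2
  have hit : ∀ (v : ℝ × ℝ) (j : ℕ), ∃ w, torusProj w = ρ^[j] (torusProj v) ∧
      periodCoords L w = α ^ j * periodCoords L v := by
    intro v j
    induction j with
    | zero => exact ⟨v, rfl, by simp⟩
    | succ j ih =>
      obtain ⟨w, hw, hw'⟩ := ih
      obtain ⟨w', h1, h2⟩ := hρ w
      refine ⟨w', ?_, ?_⟩
      · rw [h1, hw, Function.iterate_succ_apply']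
      · rw [h2, hw', pow_succ', mul_assoc]
  have hex : ∀ x, ∃ k, HasLocalDegree f x k ∧ (x = 0 → k = n) ∧
      ∀ j : ℕ, ρ^[j] x = x → n ∣ j * k := by
    intro x
    obtain ⟨v, rfl⟩ := torusProj_surjective x
    obtain ⟨k, hk, hk0, hkj⟩ := h.exists_hasLocalDegree (periodCoords L v)
    refine ⟨k, ?_, fun hv => hk0 ?_, fun j hj => hkj j ?_⟩
    · rw [← hasLocalDegree_comp_isLocalHomeomorph isLocalHomeomorph_torusProj]
      have : f ∘ torusProj = toRiemannSphere L g ∘ periodCoords L := funext hf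
      rw [this, hasLocalDegree_comp_isLocalHomeomorph (periodCoords L).isLocalHomeomorph]
      exact hk
    · have h1 := (torusProj_eq_iff L v 0).1 (by rw [hv]; rfl)
      simpa [periodCoords_apply] using h1
    · obtain ⟨w, hw, hw'⟩ := hit v j
      rw [← hw', ← torusProj_eq_iff, hw, hj]
  choose e he he0 hej using hex
  refine ⟨f, e, he, fiber_eq_orbit h.pos he ?_ ?_ hej (x₀ := 0) ?_ (he0 0 rfl)⟩
  · intro x
    obtain ⟨v, rfl⟩ := torusProj_surjective x
    obtain ⟨w, hw, hw'⟩ := hρ v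
    rw [← hw, hf, hf, hw', h.toRiemannSphere_mul]
  · intro x
    obtain ⟨v, rfl⟩ := torusProj_surjective x
    obtain ⟨w, hw, hw'⟩ := hit v n
    rw [← hw, torusProj_eq_iff L, hw', h.primitive.pow_eq_one, one_mul, sub_self]
    exact zero_mem _
  · intro x hx
    obtain ⟨v, rfl⟩ := torusProj_surjective x
    have h00 : torusProj 0 = 0 := rfl
    rw [← h00, hf, hf, toRiemannSphere_eq_infty.2 (show periodCoords L 0 ∈ L.lattice by
      simp [periodCoords_apply]), toRiemannSphere_eq_infty] at hx
    rw [← h00, torusProj_eq_iff L]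
    simpa [periodCoords_apply] using hx

/-- The branch datum of the composition of the self-covering of degree `k` and of the map defined
by a symmetric elliptic function, given representatives of the orbits of the non-free points. -/
theorem IsSymmetricElliptic.exists_isBranchedCoverWith {L : PeriodPair} {n : ℕ} {α : ℂ} {g : ℂ → ℂ}
    (h : IsSymmetricElliptic L n α g) {ρ : Torus → Torus}
    (hρ : ∀ v, ∃ w, torusProj w = ρ (torusProj v) ∧ periodCoords L w = α * periodCoords L v)
    {k : ℕ} (hk : 1 ≤ k) (R : Finset Torus)
    (hR : ∀ p, Function.minimalPeriod ρ p ≠ n → ∃ r ∈ R, ∃ i, ρ^[i] p = r)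
    (hRn : ∀ r ∈ R, Function.minimalPeriod ρ r ≠ n)
    (hRinj : ∀ r ∈ R, ∀ r' ∈ R, ∀ i, ρ^[i] r = r' → r = r') :
    ∃ F : Torus → Metric.sphere (0 : EuclideanSpace ℝ (Fin 3)) 1,
      IsBranchedCoverWith F (n * k) (R.val.map fun r => parts (Function.minimalPeriod ρ r * k)
        (n / Function.minimalPeriod ρ r)) := by
  classical
  obtain ⟨f, e, he, hsurj, hfib⟩ := h.exists_map hρ
  have hn := h.pos
  have hem : ∀ p, e p * Function.minimalPeriod ρ p = n := by
    intro p
    obtain ⟨s, -, hs, -, hse⟩ := hfib p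
    exact hse p ((hs p).2 rfl)
  have hm0 : ∀ p, 0 < Function.minimalPeriod ρ p := by
    intro p
    refine Nat.pos_of_ne_zero fun h0 => ?_
    have := hem p
    rw [h0] at this
    omega
  have hediv : ∀ p, e p = n / Function.minimalPeriod ρ p := by
    intro p
    rw [← hem p, Nat.mul_div_cancel _ (hm0 p)]
  have he1 : ∀ p, Function.minimalPeriod ρ p = n ↔ e p = 1 := by
    intro p
    have := hem p
    constructor
    · intro h1
      rw [h1] at this
      exact Nat.eq_of_mul_eq_mul_right hn (by omega)
    · intro h1
      rw [h1] at this
      omega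
  have hconst : ∀ p q, f p = f q → e p = e q := by
    intro p q hpq
    obtain ⟨s, -, hs, -, hse⟩ := hfib q
    exact Nat.eq_of_mul_eq_mul_right (hm0 q)
      ((hse p ((hs p).2 hpq)).trans (hse q ((hs q).2 rfl)).symm)
  let φ : OnePoint ℂ ≃ₜ Metric.sphere (0 : EuclideanSpace ℝ (Fin 3)) 1 :=
    onePointEquivSphereOfFinrankEq (by simp [Complex.finrank_real_complex])
  let F : Torus → Metric.sphere (0 : EuclideanSpace ℝ (Fin 3)) 1 := φ ∘ f ∘ torusCover k
  choose c hccard hcmem using exists_fiber_torusCover hk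
  choose s hscard hsf hsorb hse using hfib
  have hfibers : ∀ y, ∃ A : Finset Torus, (∀ x, x ∈ A ↔ F x = y) ∧
      ∀ p, φ (f p) = y → A.card = Function.minimalPeriod ρ p * k := by
    intro y
    obtain ⟨p, hp⟩ := hsurj (φ.symm y)
    have hpy : φ (f p) = y := by rw [hp, φ.apply_symm_apply]
    -- A fibre of the composition is the disjoint union of the `k`-point fibres of the self-covering
    -- over the points of one orbit.
    refine ⟨(s p).biUnion c, fun x => ?_, fun q hq => ?_⟩
    · rw [Finset.mem_biUnion]
      constructor
      · rintro ⟨q, hq, hx⟩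
        change φ (f (torusCover k x)) = y
        rw [(hcmem q x).1 hx, (hsf p q).1 hq, hpy]
      · intro hx
        refine ⟨torusCover k x, (hsf p _).2 (φ.injective ?_), (hcmem _ x).2 rfl⟩
        rw [hpy]
        exact hx
    · have hqp : f p = f q := φ.injective (hpy.trans hq.symm)
      have hmm : Function.minimalPeriod ρ p = Function.minimalPeriod ρ q := by
        have h1 := hem p
        rw [hconst p q hqp] at h1
        exact Nat.eq_of_mul_eq_mul_left (he q).1 (h1.trans (hem q).symm)
      rw [Finset.card_biUnion, Finset.sum_congr rfl fun x _ => hccard x, Finset.sum_const,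
        hscard p, smul_eq_mul, hmm]
      intro a _ b _ hab
      refine Finset.disjoint_left.2 fun x hxa hxb => ?_
      exact hab (((hcmem a x).1 hxa).symm.trans ((hcmem b x).1 hxb))
  choose A hA hAcard using hfibers
  have hRφ : Set.InjOn (fun r => φ (f r)) (R : Set Torus) := by
    intro r hr r' hr' hrr
    obtain ⟨i, hi⟩ := (hsorb r r').1 ((hsf r r').2 (φ.injective hrr).symm)
    exact hRinj r hr r' hr' i hi
  refine ⟨F, fun x => e (torusCover k x), A, R.image fun r => φ (f r), ?_, hA, ?_, ?_, ?_⟩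
  · intro x
    exact (hasLocalDegree_comp_torusCover hk (he _)).homeomorph_comp φ
  · intro y
    rw [Finset.mem_image]
    constructor
    · rintro ⟨r, hr, rfl⟩
      obtain ⟨x, hx⟩ := torusCover_surjective hk r
      refine ⟨x, by simp [F, hx], ?_⟩
      simp only [hx]
      have h1 := hRn r hr
      rw [Ne, he1] at h1
      have := (he r).1
      omega
    · rintro ⟨x, rfl, hx⟩
      have h1 : Function.minimalPeriod ρ (torusCover k x) ≠ n := by
        have hx' : 2 ≤ e (torusCover k x) := hx
        rw [Ne, he1]
        omega
      obtain ⟨r, hr, hi⟩ := hR _ h1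
      refine ⟨r, hr, ?_⟩
      have := (hsf _ r).1 ((hsorb _ r).2 hi)
      simp [F, this]
  · intro y hy
    obtain ⟨p, hp⟩ := hsurj (φ.symm y)
    have hpy : φ (f p) = y := by rw [hp, φ.apply_symm_apply]
    rw [hAcard y p hpy]
    congr 1
    by_contra h1
    obtain ⟨r, hr, hi⟩ := hR _ h1
    refine hy (Finset.mem_image.2 ⟨r, hr, ?_⟩)
    rw [(hsf _ r).1 ((hsorb _ r).2 hi), hpy]
  · rw [Finset.image_val_of_injOn hRφ, Multiset.map_map]
    refine Multiset.map_congr rfl fun r hr => ?_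
    rw [Function.comp, ← hediv, ← hAcard (φ (f r)) r rfl, eq_comm, Multiset.eq_replicate]
    refine ⟨by rw [Multiset.card_map]; rfl, fun b hb => ?_⟩
    obtain ⟨x, hx, rfl⟩ := Multiset.mem_map.1 hb
    exact hconst _ _ (φ.injective ((hA _ x).1 hx))

/-! ### Weierstrass functions of lattices with rotations -/

section Lattices

variable {L : PeriodPair} {α : ℂ}

/-- The inverse of `α` is `α ^ (n - 1)`, so it preserves the lattice as well. -/
theorem mul_mem_lattice_iff {n : ℕ} (hn : 1 ≤ n) (hα : α ^ n = 1)
    (h : ∀ z ∈ L.lattice, α * z ∈ L.lattice) (z : ℂ) : α * z ∈ L.lattice ↔ z ∈ L.lattice := by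
  refine ⟨fun hz => ?_, h z⟩
  have h1 : ∀ j : ℕ, ∀ z ∈ L.lattice, α ^ j * z ∈ L.lattice := by
    intro j
    induction j with
    | zero => simp
    | succ j ih =>
      intro z hz
      rw [pow_succ', mul_assoc]
      exact h _ (ih z hz)
  have h2 := h1 (n - 1) _ hz
  rwa [← mul_assoc, ← pow_succ, Nat.sub_add_cancel hn, hα, one_mul] at h2

/-- Multiplication by `α` as a permutation of a lattice it preserves. -/
noncomputable def latticeRotation (hα : α ≠ 0)
    (h : ∀ z, α * z ∈ L.lattice ↔ z ∈ L.lattice) : L.lattice ≃ L.lattice :=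
  (Equiv.mulLeft₀ α hα).subtypeEquiv fun z => (h z).symm

theorem latticeRotation_coe (hα : α ≠ 0) (h : ∀ z, α * z ∈ L.lattice ↔ z ∈ L.lattice)
    (l : L.lattice) : ((latticeRotation hα h l : L.lattice) : ℂ) = α * l := rfl

/-- Each term of the lattice sum is homogeneous of degree -2, and multiplication by `α` only
permutes the terms. -/
theorem weierstrassP_mul (hα : α ≠ 0) (h : ∀ z, α * z ∈ L.lattice ↔ z ∈ L.lattice) (z : ℂ) :
    L.weierstrassP (α * z) = (α ^ 2)⁻¹ * L.weierstrassP z := by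
  rw [PeriodPair.weierstrassP, PeriodPair.weierstrassP, ← (latticeRotation hα h).tsum_eq,
    ← tsum_mul_left]
  refine tsum_congr fun l => ?_
  rw [latticeRotation_coe, ← mul_sub, mul_pow, mul_pow, one_div, one_div, mul_inv, mul_inv]
  ring

theorem derivWeierstrassP_mul (hα : α ≠ 0) (h : ∀ z, α * z ∈ L.lattice ↔ z ∈ L.lattice) (z : ℂ) :
    L.derivWeierstrassP (α * z) = (α ^ 3)⁻¹ * L.derivWeierstrassP z := by
  rw [PeriodPair.derivWeierstrassP, PeriodPair.derivWeierstrassP,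
    ← (latticeRotation hα h).tsum_eq, mul_neg, ← tsum_mul_left]
  congr 1
  refine tsum_congr fun l => ?_
  rw [latticeRotation_coe, ← mul_sub, mul_pow, div_eq_mul_inv, div_eq_mul_inv, mul_inv]
  ring

theorem order_weierstrassP_zero (L : PeriodPair) :
    meromorphicOrderAt L.weierstrassP 0 = ((-2 : ℤ) : WithTop ℤ) := by
  rw [L.order_weierstrassP 0 (zero_mem _)]
  rfl

theorem order_derivWeierstrassP_zero (L : PeriodPair) :
    meromorphicOrderAt L.derivWeierstrassP 0 = ((-3 : ℤ) : WithTop ℤ) := by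
  rw [← L.deriv_weierstrassP,
    meromorphicOrderAt_deriv_eq_sub_one (by norm_num) (order_weierstrassP_zero L)]
  rfl

theorem isSymmetricElliptic_weierstrassP (L : PeriodPair) :
    IsSymmetricElliptic L 2 (-1) L.weierstrassP where
  pos := by norm_num
  primitive := IsPrimitiveRoot.neg_one 0 (by norm_num)
  mul_mem := fun z => by rw [neg_one_mul, neg_mem_iff]
  periodic := fun z l hl => L.weierstrassP_add_coe z ⟨l, hl⟩
  analytic := fun z hz => L.analyticOnNhd_weierstrassP z hz
  meromorphic := L.meromorphic_weierstrassP 0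
  order := order_weierstrassP_zero L
  symm := fun z => by rw [neg_one_mul, L.weierstrassP_neg]

theorem isSymmetricElliptic_derivWeierstrassP (hα : IsPrimitiveRoot α 3)
    (h : ∀ z ∈ L.lattice, α * z ∈ L.lattice) :
    IsSymmetricElliptic L 3 α L.derivWeierstrassP where
  pos := by norm_num
  primitive := hα
  mul_mem := mul_mem_lattice_iff (by norm_num) hα.pow_eq_one h
  periodic := fun z l hl => L.derivWeierstrassP_add_coe z ⟨l, hl⟩
  analytic := fun z hz => L.analyticOnNhd_derivWeierstrassP z hz
  meromorphic := L.meromorphic_derivWeierstrassP 0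
  order := order_derivWeierstrassP_zero L
  symm := fun z => by
    rw [derivWeierstrassP_mul (hα.ne_zero (by norm_num))
      (mul_mem_lattice_iff (by norm_num) hα.pow_eq_one h), hα.pow_eq_one, inv_one, one_mul]

theorem isSymmetricElliptic_weierstrassP_sq (hα : IsPrimitiveRoot α 4)
    (h : ∀ z ∈ L.lattice, α * z ∈ L.lattice) :
    IsSymmetricElliptic L 4 α (L.weierstrassP ^ 2) where
  pos := by norm_num
  primitive := hα
  mul_mem := mul_mem_lattice_iff (by norm_num) hα.pow_eq_one h
  periodic := fun z l hl => congrArg (· ^ 2) (L.weierstrassP_add_coe z ⟨l, hl⟩)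
  analytic := fun z hz => (L.analyticOnNhd_weierstrassP z hz).pow 2
  meromorphic := (L.meromorphic_weierstrassP 0).pow 2
  order := by
    rw [meromorphicOrderAt_pow (L.meromorphic_weierstrassP 0), order_weierstrassP_zero]
    rfl
  symm := fun z => by
    have h1 := weierstrassP_mul (hα.ne_zero (by norm_num))
      (mul_mem_lattice_iff (by norm_num) hα.pow_eq_one h) z
    rw [Pi.pow_apply, Pi.pow_apply, h1, mul_pow, inv_pow, ← pow_mul, hα.pow_eq_one, inv_one,
      one_mul]

theorem isSymmetricElliptic_derivWeierstrassP_sq (hα : IsPrimitiveRoot α 6)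
    (h : ∀ z ∈ L.lattice, α * z ∈ L.lattice) :
    IsSymmetricElliptic L 6 α (L.derivWeierstrassP ^ 2) where
  pos := by norm_num
  primitive := hα
  mul_mem := mul_mem_lattice_iff (by norm_num) hα.pow_eq_one h
  periodic := fun z l hl => congrArg (· ^ 2) (L.derivWeierstrassP_add_coe z ⟨l, hl⟩)
  analytic := fun z hz => (L.analyticOnNhd_derivWeierstrassP z hz).pow 2
  meromorphic := (L.meromorphic_derivWeierstrassP 0).pow 2
  order := by
    rw [meromorphicOrderAt_pow (L.meromorphic_derivWeierstrassP 0), order_derivWeierstrassP_zero]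
    rfl
  symm := fun z => by
    have h1 := derivWeierstrassP_mul (hα.ne_zero (by norm_num))
      (mul_mem_lattice_iff (by norm_num) hα.pow_eq_one h) z
    rw [Pi.pow_apply, Pi.pow_apply, h1, mul_pow, inv_pow, ← pow_mul, hα.pow_eq_one, inv_one,
      one_mul]

/-- The pair of periods `1, τ`. -/
noncomputable def periodPairOf (τ : ℂ) (hτ : τ.im ≠ 0) : PeriodPair where
  ω₁ := 1
  ω₂ := τ
  indep := by
    rw [LinearIndependent.pair_iff]
    intro s t hst
    have him := congrArg Complex.im hst
    have hre := congrArg Complex.re hst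
    simp at him hre
    have ht : t = 0 := him.resolve_right hτ
    rw [ht] at hre
    exact ⟨by simpa using hre, ht⟩

theorem periodCoords_periodPairOf {τ : ℂ} (hτ : τ.im ≠ 0) (v : ℝ × ℝ) :
    periodCoords (periodPairOf τ hτ) v = v.1 + v.2 * τ := by
  rw [periodCoords_apply]
  simp [periodPairOf]

/-- It suffices that `α` sends the two generators `1` and `τ` into the lattice. -/
theorem mul_mem_periodPairOf {τ : ℂ} (hτ : τ.im ≠ 0) (a b : ℤ) (hα : α = a + b * τ) (c d : ℤ)
    (hατ : α * τ = c + d * τ) (z : ℂ) (hz : z ∈ (periodPairOf τ hτ).lattice) :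
    α * z ∈ (periodPairOf τ hτ).lattice := by
  obtain ⟨m, n, rfl⟩ := PeriodPair.mem_lattice.1 hz
  refine PeriodPair.mem_lattice.2 ⟨m * a + n * c, m * b + n * d, ?_⟩
  simp only [periodPairOf]
  push_cast
  rw [mul_add, mul_left_comm α (n : ℂ) τ, hατ, hα]
  ring

theorem I_im_ne_zero : Complex.I.im ≠ 0 := by simp

/-- A primitive sixth root of unity. -/
noncomputable def sixthRoot : ℂ := Complex.exp (2 * Real.pi * Complex.I / (6 : ℕ))

theorem isPrimitiveRoot_sixthRoot : IsPrimitiveRoot sixthRoot 6 :=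
  Complex.isPrimitiveRoot_exp 6 (by norm_num)

/-- In `x⁶ - 1 = (x³ - 1)(x + 1)(x² - x + 1)` primitivity excludes the first two factors. -/
theorem sixthRoot_sq : sixthRoot ^ 2 = sixthRoot - 1 := by
  have h6 := isPrimitiveRoot_sixthRoot.pow_eq_one
  have h3 : sixthRoot ^ 3 ≠ 1 := isPrimitiveRoot_sixthRoot.pow_ne_one_of_pos_of_lt (by norm_num)
    (by norm_num)
  have h2 : sixthRoot ^ 2 ≠ 1 := isPrimitiveRoot_sixthRoot.pow_ne_one_of_pos_of_lt (by norm_num)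
    (by norm_num)
  have h1 : sixthRoot + 1 ≠ 0 := by
    intro h0
    apply h2
    rw [eq_neg_of_add_eq_zero_left h0]
    norm_num
  have h4 : (sixthRoot ^ 3 - 1) * ((sixthRoot + 1) * (sixthRoot ^ 2 - sixthRoot + 1)) = 0 := by
    linear_combination h6
  have h5 := ((mul_eq_zero.1 h4).resolve_left (sub_ne_zero.2 h3))
  have h7 := (mul_eq_zero.1 h5).resolve_left h1
  linear_combination h7

theorem sixthRoot_im_ne_zero : sixthRoot.im ≠ 0 := by
  intro h
  have h1 := congrArg Complex.re sixthRoot_sq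
  simp [pow_two, h] at h1
  nlinarith [sq_nonneg (sixthRoot.re - 1 / 2)]

end Lattices

/-! ### Rotations of the torus -/

section Rotations

/-- The point of order two of the circle. -/
noncomputable def half : UnitAddCircle := ((1 / 2 : ℝ) : UnitAddCircle)

/-- A point of order three of the circle. -/
noncomputable def third : UnitAddCircle := ((1 / 3 : ℝ) : UnitAddCircle)

theorem half_ne_zero : half ≠ 0 := by
  have : Fact ((0 : ℝ) < 1) := ⟨one_pos⟩
  exact (AddCircle.coe_eq_zero_iff_of_mem_Ico (p := (1 : ℝ)) (a := 1 / 2)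
    ⟨by norm_num, by norm_num⟩).not.2 (by norm_num)

theorem third_ne_zero : third ≠ 0 := by
  have : Fact ((0 : ℝ) < 1) := ⟨one_pos⟩
  exact (AddCircle.coe_eq_zero_iff_of_mem_Ico (p := (1 : ℝ)) (a := 1 / 3)
    ⟨by norm_num, by norm_num⟩).not.2 (by norm_num)

theorem half_add_half : half + half = 0 := by
  rw [half, ← AddCircle.coe_add]
  norm_num

theorem neg_half : -half = half := neg_eq_of_add_eq_zero_left half_add_half

theorem third_add_third_add_third : third + third + third = 0 := by
  rw [third, ← AddCircle.coe_add, ← AddCircle.coe_add]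
  norm_num

theorem third_add_third : third + third = -third :=
  eq_neg_of_add_eq_zero_left third_add_third_add_third

theorem neg_third_ne : -third ≠ third := by
  intro h
  have := third_add_third
  rw [h] at this
  exact third_ne_zero (by simpa using this)

theorem eq_zero_or_half {x : UnitAddCircle} (h : x + x = 0) : x = 0 ∨ x = half := by
  rw [← two_nsmul, AddCircle.nsmul_eq_zero_iff (by norm_num)] at h
  obtain ⟨m, hm, rfl⟩ := h
  interval_cases m
  · left; simp
  · right; simp [half]

theorem eq_zero_or_third {x : UnitAddCircle} (h : x + x + x = 0) :
    x = 0 ∨ x = third ∨ x = -third := by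
  have h3 : 3 • x = 0 := by rw [← h]; abel
  rw [AddCircle.nsmul_eq_zero_iff (by norm_num)] at h3
  obtain ⟨m, hm, rfl⟩ := h3
  interval_cases m
  · left; simp
  · right; left; simp [third]
  · right; right
    rw [← third_add_third, third, ← AddCircle.coe_add]
    norm_num

theorem exists_isBranchedCoverWith_two {k : ℕ} (hk : 1 ≤ k) :
    ∃ F : Torus → Metric.sphere (0 : EuclideanSpace ℝ (Fin 3)) 1,
      IsBranchedCoverWith F (2 * k) {parts k 2, parts k 2, parts k 2, parts k 2} := by
  -- For `α = -1` every lattice is invariant and the square one is an arbitrary choice. The four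
  -- 2-torsion points are the fixed points.
  let ρ : Torus → Torus := fun x => (-x.1, -x.2)
  have hL := isSymmetricElliptic_weierstrassP (periodPairOf Complex.I I_im_ne_zero)
  have hfix : ∀ x : Torus, x.1 = 0 ∨ x.1 = half → x.2 = 0 ∨ x.2 = half → ρ x = x := by
    rintro ⟨a, b⟩ h1 h2
    simp only at h1 h2
    rcases h1 with rfl | rfl <;> rcases h2 with rfl | rfl <;> simp [ρ, neg_half]
  have hper : ∀ x : Torus, x.1 = 0 ∨ x.1 = half → x.2 = 0 ∨ x.2 = half →
      Function.minimalPeriod ρ x = 1 := fun x h1 h2 =>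
    Function.minimalPeriod_eq_one_iff_isFixedPt.2 (hfix x h1 h2)
  let R : Finset Torus := ⟨{(0, 0), (half, 0), (0, half), (half, half)}, by
    simp [half_ne_zero, half_ne_zero.symm]⟩
  have hRmem : ∀ x : Torus, x ∈ R ↔ (x.1 = 0 ∨ x.1 = half) ∧ (x.2 = 0 ∨ x.2 = half) := by
    rintro ⟨a, b⟩
    simp only [R, Finset.mem_mk, Multiset.insert_eq_cons, Multiset.mem_cons,
      Multiset.mem_singleton, Prod.mk.injEq]
    tauto
  refine Exists.imp (fun F hF => ?_) (hL.exists_isBranchedCoverWith (ρ := ρ) (fun v => ⟨-v, by simp [torusProj, ρ], by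
    simp only [periodCoords_periodPairOf, Prod.fst_neg, Prod.snd_neg]
    push_cast
    ring⟩) hk R ?_ ?_ ?_)
  · convert hF using 1
    simp [R, hper]
  · intro p hp
    refine ⟨p, ?_, 0, rfl⟩
    have h2 : Function.IsPeriodicPt ρ 2 p := by
      simp [Function.IsPeriodicPt, Function.IsFixedPt, ρ]
    have h3 := (Nat.dvd_prime Nat.prime_two).1 h2.minimalPeriod_dvd
    have h4 := Function.minimalPeriod_eq_one_iff_isFixedPt.1 (h3.resolve_right hp)
    rw [hRmem]
    constructor
    · exact eq_zero_or_half (by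
        have h5 : -p.1 = p.1 := congrArg Prod.fst h4
        nth_rw 1 [← h5]
        simp)
    · exact eq_zero_or_half (by
        have h5 : -p.2 = p.2 := congrArg Prod.snd h4
        nth_rw 1 [← h5]
        simp)
  · intro r hr
    rw [hRmem] at hr
    rw [hper r hr.1 hr.2]
    norm_num
  · intro r hr r' _ i hi
    rw [hRmem] at hr
    rw [← hi, Function.iterate_fixed (hfix r hr.1 hr.2)]

theorem exists_isBranchedCoverWith_three {k : ℕ} (hk : 1 ≤ k) :
    ∃ F : Torus → Metric.sphere (0 : EuclideanSpace ℝ (Fin 3)) 1,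
      IsBranchedCoverWith F (3 * k) {parts k 3, parts k 3, parts k 3} := by
  -- Multiplication by `ζ² = ζ - 1` in the basis `1, ζ`, where `ζ` is `sixthRoot`. A fixed point has
  -- equal coordinates annihilated by 3.
  let ρ : Torus → Torus := fun x => (-x.1 - x.2, x.1)
  have hζ := sixthRoot_sq
  have hL := isSymmetricElliptic_derivWeierstrassP (α := sixthRoot ^ 2)
    (L := periodPairOf sixthRoot sixthRoot_im_ne_zero)
    (isPrimitiveRoot_sixthRoot.pow (by norm_num) (by norm_num))
    (mul_mem_periodPairOf _ (-1) 1 (by rw [hζ]; push_cast; ring) (-1) 0 (by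
      push_cast
      linear_combination (sixthRoot + 1) * hζ))
  have hfix : ∀ x ∈ ({(0, 0), (third, third), (-third, -third)} : Multiset Torus), ρ x = x := by
    intro x hx
    simp only [Multiset.insert_eq_cons, Multiset.mem_cons, Multiset.mem_singleton] at hx
    rcases hx with rfl | rfl | rfl
    · simp [ρ]
    · simp only [ρ, Prod.mk.injEq, and_true]
      rw [← third_add_third]
      abel
    · simp only [ρ, Prod.mk.injEq, and_true]
      rw [neg_neg, sub_neg_eq_add, third_add_third]
  have hper : ∀ x ∈ ({(0, 0), (third, third), (-third, -third)} : Multiset Torus),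
      Function.minimalPeriod ρ x = 1 := fun x hx =>
    Function.minimalPeriod_eq_one_iff_isFixedPt.2 (hfix x hx)
  let R : Finset Torus := ⟨{(0, 0), (third, third), (-third, -third)}, by
    simp [third_ne_zero, third_ne_zero.symm, neg_third_ne.symm]⟩
  refine Exists.imp (fun F hF => ?_) (hL.exists_isBranchedCoverWith (ρ := ρ)
    (fun v => ⟨(-v.1 - v.2, v.1), by simp [torusProj, ρ], by
      simp only [periodCoords_periodPairOf]
      push_cast
      linear_combination -((v.1 : ℂ) + v.2 * sixthRoot + v.2) * hζ⟩) hk R ?_ ?_ ?_)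
  · convert hF using 1
    rw [Multiset.map_congr rfl fun r hr => by rw [hper r hr]]
    simp [R]
  · intro p hp
    refine ⟨p, ?_, 0, rfl⟩
    have h2 : Function.IsPeriodicPt ρ 3 p := by
      have h1 : -p.2 - (-p.1 - p.2) = p.1 := by abel
      simp [h1, Function.IsPeriodicPt, Function.IsFixedPt, ρ]
    have h3 := (Nat.dvd_prime Nat.prime_three).1 h2.minimalPeriod_dvd
    have h4 := Function.minimalPeriod_eq_one_iff_isFixedPt.1 (h3.resolve_right hp)
    obtain ⟨a, b⟩ := p
    have h5 : -a - b = a := congrArg Prod.fst h4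
    have h6 : a = b := congrArg Prod.snd h4
    subst h6
    have h7 : a + a + a = 0 := by
      nth_rw 1 [← h5]
      abel
    change (a, a) ∈ ({(0, 0), (third, third), (-third, -third)} : Multiset Torus)
    rcases eq_zero_or_third h7 with rfl | rfl | rfl <;> simp
  · intro r hr
    rw [hper r hr]
    norm_num
  · intro r hr r' _ i hi
    rw [← hi, Function.iterate_fixed (hfix r hr)]

theorem exists_isBranchedCoverWith_four {k : ℕ} (hk : 1 ≤ k) :
    ∃ F : Torus → Metric.sphere (0 : EuclideanSpace ℝ (Fin 3)) 1,
      IsBranchedCoverWith F (4 * k) {parts (2 * k) 2, parts k 4, parts k 4} := by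
  -- Multiplication by `i` in the basis `1, i`. Its square is `-id`, so the non-free points are the
  -- 2-torsion ones: two are fixed, and the other two form one orbit.
  let ρ : Torus → Torus := fun x => (-x.2, x.1)
  have hL := isSymmetricElliptic_weierstrassP_sq (α := Complex.I)
    (L := periodPairOf Complex.I I_im_ne_zero) Complex.isPrimitiveRoot_I
    (mul_mem_periodPairOf _ 0 1 (by simp) (-1) 0 (by simp))
  have hp1 : Function.minimalPeriod ρ (0, 0) = 1 :=
    Function.minimalPeriod_eq_one_iff_isFixedPt.2 (by simp [Function.IsFixedPt, ρ])
  have hp1' : Function.minimalPeriod ρ (half, half) = 1 :=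
    Function.minimalPeriod_eq_one_iff_isFixedPt.2 (by simp [Function.IsFixedPt, ρ, neg_half])
  have hp2 : Function.minimalPeriod ρ (half, 0) = 2 :=
    Function.minimalPeriod_eq_prime
      (by simp [Function.IsPeriodicPt, Function.IsFixedPt, ρ, neg_half])
      (by simp [Function.IsFixedPt, ρ, half_ne_zero, half_ne_zero.symm])
  let R : Finset Torus := ⟨{(half, 0), (0, 0), (half, half)}, by
    simp [half_ne_zero, half_ne_zero.symm]⟩
  have hR : ∀ x : Torus, x ∈ R ↔ x = (half, 0) ∨ x = (0, 0) ∨ x = (half, half) := by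
    intro x
    simp [R]
  refine Exists.imp (fun F hF => ?_) (hL.exists_isBranchedCoverWith (ρ := ρ)
    (fun v => ⟨(-v.2, v.1), by simp [torusProj, ρ], by
      simp only [periodCoords_periodPairOf]
      push_cast
      linear_combination -(v.2 : ℂ) * Complex.I_sq⟩) hk R ?_ ?_ ?_)
  · convert hF using 1
    simp [R, hp1, hp1', hp2]
  · intro p hp
    have h4 : Function.IsPeriodicPt ρ 4 p := by
      simp [Function.IsPeriodicPt, Function.IsFixedPt, ρ]
    -- A divisor of 4 other than 4 divides 2.
    have h2 : Function.IsPeriodicPt ρ 2 p := by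
      rw [Function.isPeriodicPt_iff_minimalPeriod_dvd]
      have h5 := h4.minimalPeriod_dvd
      have h6 := Nat.le_of_dvd (by norm_num) h5
      interval_cases Function.minimalPeriod ρ p <;> omega
    obtain ⟨a, b⟩ := p
    have h5 : -a = a := congrArg Prod.fst h2
    have h6 : -b = b := congrArg Prod.snd h2
    have ha := eq_zero_or_half (x := a) (by nth_rw 1 [← h5]; simp)
    have hb := eq_zero_or_half (x := b) (by nth_rw 1 [← h6]; simp)
    rcases ha with rfl | rfl <;> rcases hb with rfl | rfl
    · exact ⟨_, (hR _).2 (by simp), 0, rfl⟩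
    · exact ⟨(half, 0), (hR _).2 (by simp), 1, by simp [ρ, neg_half]⟩
    · exact ⟨_, (hR _).2 (by simp), 0, rfl⟩
    · exact ⟨_, (hR _).2 (by simp), 0, rfl⟩
  · intro r hr
    rcases (hR r).1 hr with rfl | rfl | rfl
    · rw [hp2]; norm_num
    · rw [hp1]; norm_num
    · rw [hp1']; norm_num
  · intro r hr r' hr' i hi
    rcases (hR r).1 hr with rfl | rfl | rfl
    · have h1 := Function.minimalPeriod_apply_iterate (f := ρ)
        (Function.minimalPeriod_pos_iff_mem_periodicPts.1 (by rw [hp2]; norm_num)) i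
      rw [hi, hp2] at h1
      rcases (hR r').1 hr' with rfl | rfl | rfl
      · rfl
      · rw [hp1] at h1; omega
      · rw [hp1'] at h1; omega
    · rw [← hi, Function.iterate_fixed (by simp [ρ])]
    · rw [← hi, Function.iterate_fixed (by simp [ρ, neg_half])]

theorem exists_isBranchedCoverWith_six {k : ℕ} (hk : 1 ≤ k) :
    ∃ F : Torus → Metric.sphere (0 : EuclideanSpace ℝ (Fin 3)) 1,
      IsBranchedCoverWith F (6 * k) {parts (3 * k) 2, parts (2 * k) 3, parts k 6} := by
  -- Multiplication by `ζ` in the basis `1, ζ`. The square is the rotation of order three and the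
  -- cube is `-id`, so non-free points are those fixed by the former, or 2-torsion. The nonzero ones
  -- form one orbit of size 2 and one of size 3.
  let ρ : Torus → Torus := fun x => (-x.2, x.1 + x.2)
  have hζ := sixthRoot_sq
  have hL := isSymmetricElliptic_derivWeierstrassP_sq (α := sixthRoot)
    (L := periodPairOf sixthRoot sixthRoot_im_ne_zero) isPrimitiveRoot_sixthRoot
    (mul_mem_periodPairOf _ 0 1 (by simp) (-1) 1 (by
      push_cast
      linear_combination hζ))
  have hp1 : Function.minimalPeriod ρ (0, 0) = 1 :=
    Function.minimalPeriod_eq_one_iff_isFixedPt.2 (by simp [Function.IsFixedPt, ρ])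
  have hp2 : Function.minimalPeriod ρ (third, third) = 2 :=
    Function.minimalPeriod_eq_prime
      (by simp [Function.IsPeriodicPt, Function.IsFixedPt, ρ, third_add_third, ← neg_add])
      (by simp [Function.IsFixedPt, ρ, third_ne_zero])
  have hp3 : Function.minimalPeriod ρ (half, 0) = 3 :=
    Function.minimalPeriod_eq_prime
      (by simp [Function.IsPeriodicPt, Function.IsFixedPt, ρ, half_add_half, neg_half])
      (by simp [Function.IsFixedPt, ρ, half_ne_zero])
  let R : Finset Torus := ⟨{(half, 0), (third, third), (0, 0)}, by
    simp [half_ne_zero, third_ne_zero, third_ne_zero.symm]⟩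
  have hR : ∀ x : Torus, x ∈ R ↔ x = (half, 0) ∨ x = (third, third) ∨ x = (0, 0) := by
    intro x
    simp [R]
  refine Exists.imp (fun F hF => ?_) (hL.exists_isBranchedCoverWith (ρ := ρ)
    (fun v => ⟨(-v.2, v.1 + v.2), by simp [torusProj, ρ], by
      simp only [periodCoords_periodPairOf]
      push_cast
      linear_combination -(v.2 : ℂ) * hζ⟩) hk R ?_ ?_ ?_)
  · convert hF using 1
    simp [R, hp1, hp2, hp3]
  · intro p hp
    have h6 : Function.IsPeriodicPt ρ 6 p := by
      simp [Function.IsPeriodicPt, Function.IsFixedPt, ρ]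
    have h23 : Function.IsPeriodicPt ρ 2 p ∨ Function.IsPeriodicPt ρ 3 p := by
      rw [Function.isPeriodicPt_iff_minimalPeriod_dvd, Function.isPeriodicPt_iff_minimalPeriod_dvd]
      have h5 := h6.minimalPeriod_dvd
      have h7 := Nat.le_of_dvd (by norm_num) h5
      interval_cases Function.minimalPeriod ρ p <;> omega
    obtain ⟨a, b⟩ := p
    rcases h23 with h2 | h3
    · have h5 : -(a + b) = a := congrArg Prod.fst h2
      have h7 : -b + (a + b) = b := congrArg Prod.snd h2
      have hab : a = b := by rw [← h7]; abel
      subst hab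
      have h8 : a + a + a = 0 := by
        nth_rw 1 [← h5]
        abel
      rcases eq_zero_or_third h8 with rfl | rfl | rfl
      · exact ⟨_, (hR _).2 (by simp), 0, rfl⟩
      · exact ⟨_, (hR _).2 (by simp), 0, rfl⟩
      · refine ⟨(third, third), (hR _).2 (by simp), 1, ?_⟩
        simp [ρ, ← neg_add, third_add_third]
    · have h5 : -(-b + (a + b)) = a := congrArg Prod.fst h3
      have h7 : -(a + b) + (-b + (a + b)) = b := congrArg Prod.snd h3
      have ha := eq_zero_or_half (x := a) (by nth_rw 1 [← h5]; abel)
      have hb := eq_zero_or_half (x := b) (by nth_rw 1 [← h7]; abel)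
      rcases ha with rfl | rfl <;> rcases hb with rfl | rfl
      · exact ⟨_, (hR _).2 (by simp), 0, rfl⟩
      · exact ⟨(half, 0), (hR _).2 (by simp), 2, by simp [ρ, neg_half, half_add_half]⟩
      · exact ⟨_, (hR _).2 (by simp), 0, rfl⟩
      · exact ⟨(half, 0), (hR _).2 (by simp), 1, by simp [ρ, neg_half, half_add_half]⟩
  · intro r hr
    rcases (hR r).1 hr with rfl | rfl | rfl
    · rw [hp3]; norm_num
    · rw [hp2]; norm_num
    · rw [hp1]; norm_num
  · intro r hr r' hr' i hi
    have hpos : 0 < Function.minimalPeriod ρ r := by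
      rcases (hR r).1 hr with rfl | rfl | rfl <;> simp [hp1, hp2, hp3]
    have h1 := Function.minimalPeriod_apply_iterate
      (Function.minimalPeriod_pos_iff_mem_periodicPts.1 hpos) i
    rw [hi] at h1
    -- The three representatives have different periods 3, 2, 1, hence lie in different orbits.
    rcases (hR r).1 hr with rfl | rfl | rfl <;> rcases (hR r').1 hr' with rfl | rfl | rfl <;>
      first
      | rfl
      | (simp only [hp1, hp2, hp3] at h1; omega)

end Rotations

theorem realizable_of_mem_list {D : BranchDatum} {k : ℕ} (hk : 1 ≤ k)
    (h : D = ⟨1, 1, k, 0⟩ ∨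
       D = ⟨1, 0, 2 * k, {parts k 2, parts k 2, parts k 2, parts k 2}⟩ ∨
       D = ⟨1, 0, 3 * k, {parts k 3, parts k 3, parts k 3}⟩ ∨
       D = ⟨1, 0, 4 * k, {parts (2 * k) 2, parts k 4, parts k 4}⟩ ∨
       D = ⟨1, 0, 6 * k, {parts (3 * k) 2, parts (2 * k) 3, parts k 6}⟩) : D.Realizable := by
  rcases h with rfl | rfl | rfl | rfl | rfl
  · exact ⟨torusCover k, isBranchedCoverWith_torusCover hk⟩
  · exact exists_isBranchedCoverWith_two hk
  · exact exists_isBranchedCoverWith_three hk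
  · exact exists_isBranchedCoverWith_four hk
  · exact exists_isBranchedCoverWith_six hk

end Hurwitz

theorem theoremT :
    (∀ D : Hurwitz.BranchDatum,
      (D.IsCandidate ∧ ∃ X, D.Induces Hurwitz.Orbifold.torus X) ↔
        ∃ k : ℕ, 1 ≤ k ∧
          (D = ⟨1, 1, k, 0⟩ ∨
           D = ⟨1, 0, 2 * k, {Hurwitz.parts k 2, Hurwitz.parts k 2,
                  Hurwitz.parts k 2, Hurwitz.parts k 2}⟩ ∨
           D = ⟨1, 0, 3 * k, {Hurwitz.parts k 3, Hurwitz.parts k 3, Hurwitz.parts k 3}⟩ ∨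
           D = ⟨1, 0, 4 * k, {Hurwitz.parts (2 * k) 2, Hurwitz.parts k 4, Hurwitz.parts k 4}⟩ ∨
           D = ⟨1, 0, 6 * k,
                  {Hurwitz.parts (3 * k) 2, Hurwitz.parts (2 * k) 3, Hurwitz.parts k 6}⟩)) ∧
    (∀ (D : Hurwitz.BranchDatum) (X : Hurwitz.Orbifold), D.IsCandidate →
      D.Induces Hurwitz.Orbifold.torus X → X.IsEuclidean ∧ D.Realizable) := by
  refine ⟨fun D => ⟨?_, ?_⟩, ?_⟩
  · rintro ⟨hD, X, hX, -⟩
    exact hD.mem_list_of_cover_eq_torus hX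
  · rintro ⟨k, hk, h⟩
    obtain ⟨h1, h2⟩ := Hurwitz.isCandidate_and_cover_eq_torus hk h
    exact ⟨h1, _, h2, rfl⟩
  · rintro D X hD ⟨hX, rfl⟩
    obtain ⟨k, hk, h⟩ := hD.mem_list_of_cover_eq_torus hX
    exact ⟨hD.isEuclidean_baseOrbifold hX, Hurwitz.realizable_of_mem_list hk h⟩
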